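/- Let $\mathbb H_{\mathbb C}=\mathbb C\otimes_{\mathbb R}\mathbb H$ be the algebra of complexified quaternions, identified with the $2\times 2$ complex matrices $Z=\begin{pmatrix} z_{11}&z_{12}\\ z_{21}&z_{22}\end{pmatrix}$, let $N(Z)=\det Z$, let $\mathbb H_{\mathbb C}^\times=\{Z:\ N(Z)\neq 0\}$, and let $$\mathrm{Sh}=\mathbb C[z_{11},z_{12},z_{21},z_{22},N(Z)^{-1}]$$ be the space of polynomial functions on $\mathbb H_{\mathbb C}^\times$. The Lie algebra $\mathfrak{gl}(2,\mathbb H_{\mathbb C})$ acts on $\mathrm{Sh}$ by the representation $\rho$ obtained by differentiating the group action $$(\rho(h)f)(Z)=\frac{f\bigl((aZ+b)(cZ+d)^{-1}\bigr)}{N(cZ+d)^2\,N(a'-Zc')^2},\qquad h=\begin{pmatrix}a'&b'\\c'&d'\end{pmatrix}\in GL(2,\mathbb H_{\mathbb C}),\quad h^{-1}=\begin{pmatrix}a&b\\c&d\end{pmatrix}.$$ For $l\in\{0,\tfrac12,1,\tfrac32,\dots\}$ and $m,n\in\mathbb Z+l$ with $-l\le m,n\le l$ let $$t^l_{n\,m}(Z)=\frac1{2\pi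 i}\oint (sz_{11}+z_{21})^{l-m}(sz_{12}+z_{22})^{l+m}s^{-l+n}\,\frac{ds}{s},$$ the integral being taken over a loop going once counterclockwise around the origin. Let $\mathrm{Sh}^+$, $\mathrm{Sh}^-$, $\mathcal I^+$, $\mathcal I^-$, $\mathcal J$ be the $\mathbb C$-spans of the functions $N(Z)^k\,t^l_{n\,m}(Z)$ (all admissible $l,m,n$ and $k\in\mathbb Z$) subject to, respectively, $$k\ge 0;\qquad k\le -(2l+4);\qquad k\ge -(2l+1);\qquad k\le -3;\qquad -(2l+1)\le k\le -3 .$$ Then the proper (that is, different from $0$ and from $\mathrm{Sh}$) $\mathfrak{gl}(2,\mathbb H_{\mathbb C})$-invariant subspaces of $(\rho,\mathrm{Sh})$ are exactly $\mathrm{Sh}^+$, $\mathrm{Sh}^-$, $\mathcal I^+$, $\mathcal I^-$, $\mathcal J$ and their sums. The sums $\mathrm{Sh}^+\oplus\mathcal J\subseteq\mathcal I^+$ and $\mathrm{Sh}^-\oplus\mathcal J\subseteq\mathcal I^-$ are direct. The irreducible components of $(\rho,\mathrm{Sh})$ are the three subrepresentations $$\mathrm{Sh}^+,\qquad \mathrm{Sh}^-,\qquad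 \mathcal J$$ and the three quotients $$\mathcal I^+/(\mathrm{Sh}^+\oplus\mathcal J),\qquad \mathcal I^- /(\mathrm{Sh}^-\oplus\mathcal J),\qquad \mathrm{Sh}/(\mathcal I^++\mathcal I^-);$$ that is, these six representations are irreducible, $(\rho,\mathrm{Sh})$ has a composition series of length six whose factors are, up to isomorphism and order, these six representations, each occurring once in the list of factors, and every irreducible subquotient of $(\rho,\mathrm{Sh})$ is isomorphic to one of them. -/

import Mathlib

noncomputable section

namespace Biquaternion

open Matrix

/-- The algebra `ℍ_ℂ = ℂ ⊗ ℍ` of complexified quaternions, in its standard realization by complex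
`2 × 2` matrices `Z = (z_ij)`; the norm `N(Z)` is `det Z`, the trace is the matrix trace, and
`HCˣ` is the set `ℍ_ℂ^×` of invertible elements. -/
abbrev HC : Type := Matrix (Fin 2) (Fin 2) ℂ

/-- The algebra `gl(2, ℍ_ℂ)` of `2 × 2` matrices with entries in `ℍ_ℂ`; its group of units is
`GL(2, ℍ_ℂ)`. -/
abbrev Gl2HC : Type := Matrix (Fin 2) (Fin 2) HC

/-- The Lie bracket of `gl(2, ℍ_ℂ)` is the commutator. -/
instance instLieRingGl2HC : LieRing Gl2HC := LieRing.ofAssociativeRing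

instance instLieAlgebraGl2HC : LieAlgebra ℂ Gl2HC := LieAlgebra.ofAssociativeAlgebra

/-- The polynomial functions on `ℍ_ℂ^×`: the algebra `ℂ[z₁₁, z₁₂, z₂₁, z₂₂, N(Z)⁻¹]`. -/
def Sh : Subalgebra ℂ (HCˣ → ℂ) :=
  Algebra.adjoin ℂ ({f | ∃ i j, f = fun Z => Z.val i j} ∪ {fun Z => (Z.val.det)⁻¹})

open Classical in
/-- Extension of a function on `ℍ_ℂ^×` to `ℍ_ℂ` by zero. -/
def ext (f : HCˣ → ℂ) (W : HC) : ℂ := if hW : IsUnit W then f hW.unit else 0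

/-- The action `ρ` of `GL(2, ℍ_ℂ)`:
`(ρ(h) f)(Z) = f((aZ+b)(cZ+d)⁻¹) / (N(cZ+d)² N(a'-Zc')²)`, where
`h = (a' b'; c' d')` and `h⁻¹ = (a b; c d)`, for those `h` and `Z` for which the right hand
side makes sense (for given `Z`, this includes all `h` near the identity). -/
def rhoGroup (h : Gl2HCˣ) (f : HCˣ → ℂ) (Z : HCˣ) : ℂ :=
  let a := h⁻¹.val 0 0
  let b := h⁻¹.val 0 1
  let c := h⁻¹.val 1 0
  let d := h⁻¹.val 1 1
  let a' := h.val 0 0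
  let c' := h.val 1 0
  ext f ((a * Z.val + b) * (c * Z.val + d)⁻¹) /
    ((c * Z.val + d).det ^ 2 * (a' - Z.val * c').det ^ 2)

open scoped Matrix.Norms.Operator in
theorem exp_mul_exp_neg (X : Gl2HC) : NormedSpace.exp X * NormedSpace.exp (-X) = 1 := by
  have h := NormedSpace.exp_add_of_commute (Commute.refl X).neg_right
  rw [add_neg_cancel, NormedSpace.exp_zero] at h
  exact h.symm

/-- The exponential map `gl(2, ℍ_ℂ) → GL(2, ℍ_ℂ)`. -/
def expUnit (X : Gl2HC) : Gl2HCˣ where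
  val := NormedSpace.exp X
  inv := NormedSpace.exp (-X)
  val_inv := exp_mul_exp_neg X
  inv_val := by simpa using exp_mul_exp_neg (-X)

/-- The action of the Lie algebra `gl(2, ℍ_ℂ)` obtained by differentiating `ρ`:
`(ρ(X) f)(Z) = d/dt (ρ(exp(tX)) f)(Z)` at `t = 0`. -/
def rhoLie (X : Gl2HC) (f : HCˣ → ℂ) (Z : HCˣ) : ℂ :=
  deriv (fun t : ℂ => rhoGroup (expUnit (t • X)) f Z) 0

/-! ### Partial derivatives of polynomial functions -/

/-- The partial derivative `∂_ij = ∂/∂z_ij`. -/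
def pd (i j : Fin 2) (f : HCˣ → ℂ) (Z : HCˣ) : ℂ :=
  deriv (fun t : ℂ => ext f (Z.val + t • Matrix.single i j 1)) 0

theorem ext_coe (f : HCˣ → ℂ) (Z : HCˣ) : ext f Z.val = f Z := by
  have h : IsUnit Z.val := Z.isUnit
  rw [ext, dif_pos h]
  congr 1
  exact Units.ext rfl

theorem det_ne_zero (Z : HCˣ) : Z.val.det ≠ 0 :=
  ((Matrix.isUnit_iff_isUnit_det _).1 Z.isUnit).ne_zero

theorem curve_det {γ : ℂ → HC} {γ' : HC}
    (h : ∀ i j, HasDerivAt (fun t => γ t i j) (γ' i j) 0) :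
    HasDerivAt (fun t => (γ t).det)
      (γ' 0 0 * γ 0 1 1 + γ 0 0 0 * γ' 1 1 - (γ' 0 1 * γ 0 1 0 + γ 0 0 1 * γ' 1 0)) 0 := by
  simp only [Matrix.det_fin_two]
  exact ((h 0 0).mul (h 1 1)).sub ((h 0 1).mul (h 1 0))

theorem curve_unit {γ : ℂ → HC} {γ' : HC} {Z : HCˣ} (h0 : γ 0 = Z.val)
    (h : ∀ i j, HasDerivAt (fun t => γ t i j) (γ' i j) 0) :
    ∀ᶠ t in nhds 0, IsUnit (γ t) := by
  have h1 := (curve_det h).continuousAt.eventually_ne (by simpa [h0] using det_ne_zero Z)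
  filter_upwards [h1] with t ht
  exact (Matrix.isUnit_iff_isUnit_det _).2 (isUnit_iff_ne_zero.2 ht)

/-- `G` is the gradient of `f`, in the sense of the chain rule along curves. -/
def HasGrad (f : HCˣ → ℂ) (G : Fin 2 → Fin 2 → HCˣ → ℂ) : Prop :=
  ∀ (Z : HCˣ) (γ : ℂ → HC) (γ' : HC), γ 0 = Z.val →
    (∀ i j, HasDerivAt (fun t => γ t i j) (γ' i j) 0) →
    HasDerivAt (fun t => ext f (γ t)) (∑ i, ∑ j, γ' i j * G i j Z) 0

theorem HasGrad.eq_pd {f : HCˣ → ℂ} {G : Fin 2 → Fin 2 → HCˣ → ℂ} (h : HasGrad f G) :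
    G = fun i j => pd i j f := by
  funext i j Z
  have h1 := h Z (fun t => Z.val + t • Matrix.single i j 1) (Matrix.single i j 1) (by simp) (by
    intro k l
    have : HasDerivAt (fun t : ℂ => Z.val k l + t * Matrix.single i j (1 : ℂ) k l)
        (1 * Matrix.single i j (1 : ℂ) k l) 0 :=
      ((hasDerivAt_id (0 : ℂ)).mul_const _).const_add _
    simpa [Matrix.add_apply, Matrix.smul_apply, -Matrix.smul_single] using this)
  rw [pd, h1.deriv]
  simp [Matrix.single_apply, ite_and]

theorem hasGrad_coord (i j : Fin 2) :
    HasGrad (fun Z => Z.val i j) (fun k l _ => if k = i ∧ l = j then 1 else 0) := by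
  intro Z γ γ' h0 h
  have h1 : HasDerivAt (fun t => γ t i j)
      (∑ k, ∑ l, γ' k l * (if k = i ∧ l = j then 1 else 0)) 0 := by
    convert h i j using 1
    simp [ite_and]
  refine h1.congr_of_eventuallyEq ?_
  filter_upwards [curve_unit h0 h] with t ht
  simp [ext, ht]

theorem hasGrad_const (c : ℂ) : HasGrad (fun _ => c) (fun _ _ _ => 0) := by
  intro Z γ γ' h0 h
  have h1 : HasDerivAt (fun _ : ℂ => c) (∑ k, ∑ l, γ' k l * 0) 0 := by
    simpa using hasDerivAt_const (0 : ℂ) c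
  refine h1.congr_of_eventuallyEq ?_
  filter_upwards [curve_unit h0 h] with t ht
  simp [ext, ht]

theorem HasGrad.add {f g : HCˣ → ℂ} {F G : Fin 2 → Fin 2 → HCˣ → ℂ} (hf : HasGrad f F)
    (hg : HasGrad g G) : HasGrad (f + g) (F + G) := by
  intro Z γ γ' h0 h
  have h1 := (hf Z γ γ' h0 h).add (hg Z γ γ' h0 h)
  refine (h1.congr_of_eventuallyEq ?_).congr_deriv ?_
  · filter_upwards [curve_unit h0 h] with t ht
    simp [ext, ht]
  · simp [mul_add, Finset.sum_add_distrib]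

theorem HasGrad.mul {f g : HCˣ → ℂ} {F G : Fin 2 → Fin 2 → HCˣ → ℂ} (hf : HasGrad f F)
    (hg : HasGrad g G) :
    HasGrad (f * g) (fun i j => f * G i j + g * F i j) := by
  intro Z γ γ' h0 h
  have h1 := (hf Z γ γ' h0 h).mul (hg Z γ γ' h0 h)
  refine (h1.congr_of_eventuallyEq ?_).congr_deriv ?_
  · filter_upwards [curve_unit h0 h] with t ht
    simp [ext, ht]
  · simp only [h0, ext_coe, Fin.sum_univ_two, Pi.add_apply, Pi.mul_apply]
    ring

theorem coord_mem (i j : Fin 2) : (fun Z : HCˣ => Z.val i j) ∈ Sh :=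
  Algebra.subset_adjoin (Or.inl ⟨i, j, rfl⟩)

theorem detInv_mem : (fun Z : HCˣ => (Z.val.det)⁻¹) ∈ Sh :=
  Algebra.subset_adjoin (Or.inr rfl)

/-- The coordinate function `z_ij`. -/
def coord (i j : Fin 2) : Sh := ⟨_, coord_mem i j⟩

/-- The function `N(Z)⁻¹`. -/
def detInv : Sh := ⟨_, detInv_mem⟩

theorem det_mem : (fun Z : HCˣ => Z.val.det) ∈ Sh := by
  have := (coord 0 0 * coord 1 1 - coord 0 1 * coord 1 0).2
  convert this using 1
  funext Z
  simp [Matrix.det_fin_two, coord]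

/-- `∂N/∂z_ij`, the cofactors. -/
def cof (i j : Fin 2) : Sh := !![coord 1 1, -coord 1 0; -coord 0 1, coord 0 0] i j

theorem hasGrad_detInv : HasGrad (fun Z => (Z.val.det)⁻¹)
    (fun i j => -(detInv * detInv * cof i j : Sh)) := by
  intro Z γ γ' h0 h
  have h1 := (curve_det h).inv (by simpa [h0] using det_ne_zero Z)
  refine (h1.congr_of_eventuallyEq ?_).congr_deriv ?_
  · filter_upwards [curve_unit h0 h] with t ht
    simp [ext, ht]
  · simp [h0, Fin.sum_univ_two, cof, coord, detInv]
    ring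

theorem exists_grad {f : HCˣ → ℂ} (hf : f ∈ Sh) :
    ∃ G : Fin 2 → Fin 2 → HCˣ → ℂ, (∀ i j, G i j ∈ Sh) ∧ HasGrad f G := by
  induction hf using Algebra.adjoin_induction with
  | mem x hx =>
    rcases hx with ⟨i, j, rfl⟩ | rfl
    · refine ⟨_, fun k l => ?_, hasGrad_coord i j⟩
      by_cases h : k = i ∧ l = j
      · simp only [h, and_self, if_true]; exact one_mem Sh
      · simp only [h, if_false]; exact zero_mem Sh
    · exact ⟨_, fun i j => neg_mem (detInv * detInv * cof i j : Sh).2, hasGrad_detInv⟩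
  | algebraMap r => exact ⟨_, fun _ _ => zero_mem Sh, hasGrad_const r⟩
  | add f g _ _ hf hg =>
    obtain ⟨F, hF, hf⟩ := hf
    obtain ⟨G, hG, hg⟩ := hg
    exact ⟨_, fun i j => add_mem (hF i j) (hG i j), hf.add hg⟩
  | mul f g hf' hg' hf hg =>
    obtain ⟨F, hF, hf⟩ := hf
    obtain ⟨G, hG, hg⟩ := hg
    exact ⟨_, fun i j => add_mem (mul_mem hf' (hG i j)) (mul_mem hg' (hF i j)), hf.mul hg⟩

theorem hasGrad_pd {f : HCˣ → ℂ} (hf : f ∈ Sh) : HasGrad f (fun i j => pd i j f) := by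
  obtain ⟨G, _, h⟩ := exists_grad hf
  rwa [← h.eq_pd]

theorem pd_mem (i j : Fin 2) {f : HCˣ → ℂ} (hf : f ∈ Sh) : pd i j f ∈ Sh := by
  obtain ⟨G, hG, h⟩ := exists_grad hf
  have := hG i j
  rwa [h.eq_pd] at this

theorem pd_mul (i j : Fin 2) {f g : HCˣ → ℂ} (hf : f ∈ Sh) (hg : g ∈ Sh) :
    pd i j (f * g) = f * pd i j g + g * pd i j f :=
  (congrFun (congrFun ((hasGrad_pd hf).mul (hasGrad_pd hg)).eq_pd i) j).symm

theorem pd_add (i j : Fin 2) {f g : HCˣ → ℂ} (hf : f ∈ Sh) (hg : g ∈ Sh) :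
    pd i j (f + g) = pd i j f + pd i j g :=
  (congrFun (congrFun ((hasGrad_pd hf).add (hasGrad_pd hg)).eq_pd i) j).symm

theorem pd_const (i j : Fin 2) (c : ℂ) : pd i j (fun _ => c) = 0 :=
  (congrFun (congrFun (hasGrad_const c).eq_pd i) j).symm

/-- `∂_ij` as a derivation of the algebra of polynomial functions. -/
def pdD (i j : Fin 2) : Derivation ℂ Sh Sh :=
  Derivation.mk'
    { toFun := fun f => ⟨pd i j f, pd_mem i j f.2⟩
      map_add' := fun f g => Subtype.ext (pd_add i j f.2 g.2)
      map_smul' := fun c f => Subtype.ext (by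
        have h := pd_mul i j (Sh.algebraMap_mem c) f.2
        have h2 : pd i j (algebraMap ℂ (HCˣ → ℂ) c) = 0 := pd_const i j c
        rw [h2, mul_zero, add_zero] at h
        simpa [Algebra.smul_def] using h) }
    (fun f g => Subtype.ext (pd_mul i j f.2 g.2))

theorem pdD_coe (i j : Fin 2) (f : Sh) : (pdD i j f : HCˣ → ℂ) = pd i j f := rfl

theorem pdD_coord (i j k l : Fin 2) :
    pdD i j (coord k l) = if i = k ∧ j = l then 1 else 0 := by
  apply Subtype.ext
  have := congrFun (congrFun (hasGrad_coord k l).eq_pd i) j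
  rw [pdD_coe]
  refine this.symm.trans ?_
  split_ifs <;> rfl

/-! ### The explicit form of the Lie algebra action -/

/-- The matrix of coordinate functions. -/
def Zmat : Matrix (Fin 2) (Fin 2) Sh := Matrix.of coord

/-- A constant matrix. -/
def cmat (A : HC) : Matrix (Fin 2) (Fin 2) Sh := A.map (algebraMap ℂ Sh)

/-- The coefficients `-AZ - B + ZCZ + ZD` of the vector field defined by `X = (A B; C D)`. -/
def vmat (X : Gl2HC) : Matrix (Fin 2) (Fin 2) Sh :=
  -(cmat (X 0 0) * Zmat) - cmat (X 0 1) + Zmat * cmat (X 1 0) * Zmat + Zmat * cmat (X 1 1)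

/-- The multiplier `-2 Tr A + 4 Tr(CZ) + 2 Tr D` defined by `X = (A B; C D)`. -/
def mult (X : Gl2HC) : Sh :=
  -2 * (cmat (X 0 0)).trace + 4 * (cmat (X 1 0) * Zmat).trace + 2 * (cmat (X 1 1)).trace

/-- The first order part `Tr((-AZ - B + ZCZ + ZD) ∂)` of the action of `X = (A B; C D)`. -/
def vecField (X : Gl2HC) : Derivation ℂ Sh Sh := ∑ i, ∑ j, vmat X i j • pdD i j

theorem vecField_apply (X : Gl2HC) (f : Sh) :
    vecField X f = ∑ i, ∑ j, vmat X i j * pdD i j f := by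
  simp [vecField, Fin.sum_univ_two]

theorem vmat_coe (X : Gl2HC) (i j : Fin 2) (Z : HCˣ) :
    (vmat X i j).val Z =
      (-(X 0 0 * Z.val) - X 0 1 + Z.val * X 1 0 * Z.val + Z.val * X 1 1) i j := by
  simp [vmat, Matrix.mul_apply, Fin.sum_univ_two, cmat, Zmat, coord]

theorem mult_coe (X : Gl2HC) (Z : HCˣ) :
    (mult X).val Z = -2 * (X 0 0).trace + 4 * (X 1 0 * Z.val).trace + 2 * (X 1 1).trace := by
  have h2 : (2 : Sh).val Z = 2 := rfl
  have h4 : (4 : Sh).val Z = 4 := rfl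
  simp [mult, h2, h4, Matrix.mul_apply, Fin.sum_univ_two, cmat, Zmat, coord, Matrix.trace_fin_two]

open scoped Matrix.Norms.Operator in
theorem exp_entry (X : Gl2HC) (p q i j : Fin 2) :
    HasDerivAt (fun t : ℂ => NormedSpace.exp (t • X) p q i j) (X p q i j) 0 := by
  have h := hasDerivAt_exp_smul_const (𝕂 := ℂ) X 0
  simp only [zero_smul, NormedSpace.exp_zero, one_mul] at h
  have h1 := hasDerivAt_pi.1 (hasDerivAt_pi.1 h p) q
  exact hasDerivAt_pi.1 (hasDerivAt_pi.1 h1 i) j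

theorem exp_zero_smul (X : Gl2HC) : NormedSpace.exp ((0 : ℂ) • X) = 1 := by
  rw [zero_smul, NormedSpace.exp_zero]

theorem mul_entry {γ δ : ℂ → HC} {γ' δ' : HC}
    (hγ : ∀ i j, HasDerivAt (fun t => γ t i j) (γ' i j) 0)
    (hδ : ∀ i j, HasDerivAt (fun t => δ t i j) (δ' i j) 0) (i j : Fin 2) :
    HasDerivAt (fun t => (γ t * δ t) i j) ((γ' * δ 0 + γ 0 * δ') i j) 0 := by
  simp only [Matrix.mul_apply, Fin.sum_univ_two, Matrix.add_apply]
  refine (((hγ i 0).mul (hδ 0 j)).add ((hγ i 1).mul (hδ 1 j))).congr_deriv ?_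
  ring

theorem inv_entry {γ : ℂ → HC} {γ' : HC} (h0 : γ 0 = 1)
    (h : ∀ i j, HasDerivAt (fun t => γ t i j) (γ' i j) 0) (i j : Fin 2) :
    HasDerivAt (fun t => (γ t)⁻¹ i j) ((-γ') i j) 0 := by
  have hd := (curve_det h).inv (by simp [h0])
  have ha : ∀ i j, HasDerivAt (fun t => (γ t).adjugate i j) (γ'.adjugate i j) 0 := by
    intro i j
    simp only [Matrix.adjugate_fin_two]
    fin_cases i <;> fin_cases j
    · exact h 1 1
    · exact (h 0 1).neg
    · exact (h 1 0).neg
    · exact h 0 0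
  have hm := hd.mul (ha i j)
  simp only [Matrix.inv_def, Ring.inverse_eq_inv', Matrix.smul_apply, smul_eq_mul]
  refine hm.congr_deriv ?_
  simp only [h0, Matrix.adjugate_fin_two]
  fin_cases i <;> fin_cases j <;> simp [h0]

theorem hasDerivAt_moebius (f : Sh) (Z : HCˣ) {a b c d p r : ℂ → HC} {a' b' c' d' p' r' : HC}
    (ha0 : a 0 = 1) (hb0 : b 0 = 0) (hc0 : c 0 = 0) (hd0 : d 0 = 1) (hp0 : p 0 = 1) (hr0 : r 0 = 0)
    (ha : ∀ i j, HasDerivAt (fun t => a t i j) (a' i j) 0)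
    (hb : ∀ i j, HasDerivAt (fun t => b t i j) (b' i j) 0)
    (hc : ∀ i j, HasDerivAt (fun t => c t i j) (c' i j) 0)
    (hd : ∀ i j, HasDerivAt (fun t => d t i j) (d' i j) 0)
    (hp : ∀ i j, HasDerivAt (fun t => p t i j) (p' i j) 0)
    (hr : ∀ i j, HasDerivAt (fun t => r t i j) (r' i j) 0) :
    HasDerivAt (fun t => ext f ((a t * Z.val + b t) * (c t * Z.val + d t)⁻¹) /
        ((c t * Z.val + d t).det ^ 2 * (p t - Z.val * r t).det ^ 2))
      ((∑ i, ∑ j, (a' * Z.val + b' - Z.val * (c' * Z.val + d')) i j * pd i j f Z) -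
        2 * ((c' * Z.val + d').trace + (p' - Z.val * r').trace) * f.val Z) 0 := by
  have hz : ∀ i j, HasDerivAt (fun _ : ℂ => Z.val i j) ((0 : HC) i j) 0 := fun i j =>
    hasDerivAt_const _ _
  have hnum : ∀ i j, HasDerivAt (fun t => (a t * Z.val + b t) i j) ((a' * Z.val + b') i j) 0 :=
    fun i j => ((mul_entry ha hz i j).add (hb i j)).congr_deriv (by simp)
  have hden : ∀ i j, HasDerivAt (fun t => (c t * Z.val + d t) i j) ((c' * Z.val + d') i j) 0 :=
    fun i j => ((mul_entry hc hz i j).add (hd i j)).congr_deriv (by simp)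
  have hden' : ∀ i j, HasDerivAt (fun t => (p t - Z.val * r t) i j) ((p' - Z.val * r') i j) 0 :=
    fun i j => ((hp i j).sub (mul_entry hz hr i j)).congr_deriv (by simp)
  have hden0 : c 0 * Z.val + d 0 = 1 := by rw [hc0, hd0, zero_mul, zero_add]
  have hdenp : p 0 - Z.val * r 0 = 1 := by rw [hp0, hr0, mul_zero, sub_zero]
  have hnum0 : a 0 * Z.val + b 0 = Z.val := by rw [ha0, hb0, one_mul, add_zero]
  have hinv := inv_entry hden0 hden
  have harg : ∀ i j, HasDerivAt (fun t => ((a t * Z.val + b t) * (c t * Z.val + d t)⁻¹) i j)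
      ((a' * Z.val + b' - Z.val * (c' * Z.val + d')) i j) 0 := fun i j =>
    (mul_entry hnum hinv i j).congr_deriv (by
      rw [hden0, hnum0, inv_one, mul_one, mul_neg, ← sub_eq_add_neg])
  have hf := hasGrad_pd f.2 Z _ _ (by rw [hden0, hnum0, inv_one, mul_one]) harg
  have hd1 := (curve_det hden).pow 2
  have hd2 := (curve_det hden').pow 2
  have hmain := hf.div (hd1.mul hd2) (by
    simp only [Pi.mul_apply, Pi.pow_apply, hden0, hdenp]; simp)
  refine hmain.congr_deriv ?_
  simp only [Pi.mul_apply, Pi.pow_apply, hden0, hdenp, hnum0, inv_one, mul_one, ext_coe,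
    Matrix.trace_fin_two, Matrix.det_one]
  simp only [Matrix.one_apply_eq, one_pow, ne_eq, zero_ne_one, one_ne_zero,
    not_false_eq_true, Matrix.one_apply_ne]
  push_cast
  ring

theorem hasDerivAt_rhoGroup (X : Gl2HC) (f : Sh) (Z : HCˣ) :
    HasDerivAt (fun t : ℂ => rhoGroup (expUnit (t • X)) f Z)
      ((vecField X f + mult X * f : Sh).val Z) 0 := by
  have hp : ∀ p q i j, HasDerivAt (fun t : ℂ => (expUnit (t • X)).val p q i j)
      (X p q i j) 0 := exp_entry X
  have hm : ∀ p q i j, HasDerivAt (fun t : ℂ => (expUnit (t • X))⁻¹.val p q i j)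
      ((-X) p q i j) 0 := by
    intro p q i j
    refine (exp_entry (-X) p q i j).congr_of_eventuallyEq (Filter.Eventually.of_forall ?_)
    intro t
    change NormedSpace.exp (-(t • X)) p q i j = NormedSpace.exp (t • -X) p q i j
    rw [smul_neg]
  have hp0 : (expUnit ((0 : ℂ) • X)).val = 1 := exp_zero_smul X
  have hm0 : (expUnit ((0 : ℂ) • X))⁻¹.val = 1 := by
    change NormedSpace.exp (-((0 : ℂ) • X)) = 1
    rw [zero_smul, neg_zero, NormedSpace.exp_zero]
  have hmain := hasDerivAt_moebius f Z
    (a := fun t => (expUnit (t • X))⁻¹.val 0 0) (b := fun t => (expUnit (t • X))⁻¹.val 0 1)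
    (c := fun t => (expUnit (t • X))⁻¹.val 1 0) (d := fun t => (expUnit (t • X))⁻¹.val 1 1)
    (p := fun t => (expUnit (t • X)).val 0 0) (r := fun t => (expUnit (t • X)).val 1 0)
    (congrFun (congrFun hm0 0) 0) (congrFun (congrFun hm0 0) 1)
    (congrFun (congrFun hm0 1) 0) (congrFun (congrFun hm0 1) 1)
    (congrFun (congrFun hp0 0) 0) (congrFun (congrFun hp0 1) 0)
    (hm 0 0) (hm 0 1) (hm 1 0) (hm 1 1) (hp 0 0) (hp 1 0)
  refine HasDerivAt.congr_deriv hmain ?_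
  have hv : (vecField X f + mult X * f : Sh).val Z =
      (∑ i, ∑ j, (vmat X i j).val Z * pd i j f Z) + (mult X).val Z * f.val Z := by
    rw [vecField_apply]
    simp [Fin.sum_univ_two, pdD_coe]
  rw [hv, mult_coe]
  simp only [vmat_coe]
  simp only [Fin.sum_univ_two, Matrix.mul_apply, Matrix.trace_fin_two, Matrix.add_apply,
    Matrix.sub_apply, Matrix.neg_apply]
  ring

theorem rhoLie_eq (X : Gl2HC) (f : Sh) :
    rhoLie X f = (vecField X f + mult X * f : Sh).val :=
  funext fun Z => (hasDerivAt_rhoGroup X f Z).deriv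

theorem rhoLie_mem (X : Gl2HC) (f : Sh) : rhoLie X f ∈ Sh := by
  rw [rhoLie_eq]
  exact Subtype.property _

theorem vecField_coord (X : Gl2HC) (i j : Fin 2) : vecField X (coord i j) = vmat X i j := by
  rw [vecField_apply]
  simp only [pdD_coord]
  simp [ite_and]

theorem derivation_ext {D E : Derivation ℂ Sh Sh} (h : ∀ i j, D (coord i j) = E (coord i j)) :
    D = E := by
  have hdet : (coord 0 0 * coord 1 1 - coord 0 1 * coord 1 0) * detInv = 1 := by
    apply Subtype.ext
    funext Z
    have := mul_inv_cancel₀ (det_ne_zero Z)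
    rw [Matrix.det_fin_two] at this
    simpa [coord, detInv, Matrix.det_fin_two] using this
  have hinv : D detInv = E detInv := by
    rw [Derivation.leibniz_of_mul_eq_one D ((mul_comm _ _).trans hdet),
      Derivation.leibniz_of_mul_eq_one E ((mul_comm _ _).trans hdet)]
    simp only [map_sub, Derivation.leibniz, h]
  ext1 ⟨f, hf⟩
  induction hf using Algebra.adjoin_induction with
  | mem x hx =>
    rcases hx with ⟨i, j, rfl⟩ | rfl
    · exact h i j
    · exact hinv
  | algebraMap r =>
    have h1 : (⟨algebraMap ℂ (HCˣ → ℂ) r, Sh.algebraMap_mem r⟩ : Sh) = algebraMap ℂ Sh r := rfl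
    exact (congrArg D h1).trans ((D.map_algebraMap r).trans
      ((E.map_algebraMap r).symm.trans (congrArg E h1).symm))
  | add f g hf' hg' hf hg =>
    have h1 : (⟨f + g, add_mem hf' hg'⟩ : Sh) = ⟨f, hf'⟩ + ⟨g, hg'⟩ := rfl
    exact (congrArg D h1).trans (Eq.trans (by rw [map_add, map_add, hf, hg]) (congrArg E h1).symm)
  | mul f g hf' hg' hf hg =>
    have h1 : (⟨f * g, mul_mem hf' hg'⟩ : Sh) = ⟨f, hf'⟩ * ⟨g, hg'⟩ := rfl
    exact (congrArg D h1).trans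
      (Eq.trans (by rw [D.leibniz, E.leibniz, hf, hg]) (congrArg E h1).symm)

theorem bracket_entry (X Y : Gl2HC) (p q i j : Fin 2) :
    ⁅X, Y⁆ p q i j = (X p 0 * Y 0 q + X p 1 * Y 1 q - (Y p 0 * X 0 q + Y p 1 * X 1 q)) i j := by
  rw [LieRing.of_associative_ring_bracket]
  simp [Matrix.sub_apply, Matrix.mul_apply, Fin.sum_univ_two, Matrix.add_apply]

theorem vmat_entry (X : Gl2HC) (i j : Fin 2) :
    vmat X i j = -(algebraMap ℂ Sh (X 0 0 i 0) * coord 0 j +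
        algebraMap ℂ Sh (X 0 0 i 1) * coord 1 j) - algebraMap ℂ Sh (X 0 1 i j) +
      ((coord i 0 * algebraMap ℂ Sh (X 1 0 0 0) + coord i 1 * algebraMap ℂ Sh (X 1 0 1 0)) *
          coord 0 j +
        (coord i 0 * algebraMap ℂ Sh (X 1 0 0 1) + coord i 1 * algebraMap ℂ Sh (X 1 0 1 1)) *
          coord 1 j) +
      (coord i 0 * algebraMap ℂ Sh (X 1 1 0 j) + coord i 1 * algebraMap ℂ Sh (X 1 1 1 j)) := by
  simp [vmat, Matrix.mul_apply, Fin.sum_univ_two, cmat, Zmat]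

theorem mult_entry (X : Gl2HC) :
    mult X = -2 * (algebraMap ℂ Sh (X 0 0 0 0) + algebraMap ℂ Sh (X 0 0 1 1)) +
      4 * (algebraMap ℂ Sh (X 1 0 0 0) * coord 0 0 + algebraMap ℂ Sh (X 1 0 0 1) * coord 1 0 +
        (algebraMap ℂ Sh (X 1 0 1 0) * coord 0 1 + algebraMap ℂ Sh (X 1 0 1 1) * coord 1 1)) +
      2 * (algebraMap ℂ Sh (X 1 1 0 0) + algebraMap ℂ Sh (X 1 1 1 1)) := by
  simp [mult, Matrix.mul_apply, Fin.sum_univ_two, cmat, Zmat, Matrix.trace_fin_two]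

theorem vecField_algebraMap (X : Gl2HC) (c : ℂ) : vecField X (algebraMap ℂ Sh c) = 0 :=
  Derivation.map_algebraMap _ c

theorem vecField_two (X : Gl2HC) : vecField X 2 = 0 :=
  Derivation.map_natCast (vecField X) 2

theorem vecField_four (X : Gl2HC) : vecField X 4 = 0 :=
  Derivation.map_natCast (vecField X) 4

theorem vecField_lie (X Y : Gl2HC) : vecField ⁅X, Y⁆ = ⁅vecField X, vecField Y⁆ := by
  apply derivation_ext
  intro i j
  rw [Derivation.commutator_apply]
  simp only [vecField_coord]
  simp only [vmat_entry, bracket_entry, map_add, map_sub, map_neg, Derivation.leibniz, smul_eq_mul,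
    vecField_algebraMap, vecField_coord, mul_zero, zero_add, add_zero, Matrix.mul_apply,
    Matrix.add_apply, Matrix.sub_apply, Fin.sum_univ_two, map_mul]
  ring

theorem mult_lie (X Y : Gl2HC) :
    mult ⁅X, Y⁆ = vecField X (mult Y) - vecField Y (mult X) := by
  simp only [mult_entry, bracket_entry, map_add, map_sub, map_neg, Derivation.leibniz, smul_eq_mul,
    vecField_algebraMap, vecField_two, vecField_four, vecField_coord, vmat_entry, mul_zero, zero_add, add_zero,
    Matrix.mul_apply, neg_zero,
    Matrix.add_apply, Matrix.sub_apply, Fin.sum_univ_two, map_mul]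
  ring

theorem vmat_add (X Y : Gl2HC) (i j : Fin 2) : vmat (X + Y) i j = vmat X i j + vmat Y i j := by
  simp only [vmat_entry, Matrix.add_apply, map_add]
  ring

theorem vmat_smul (c : ℂ) (X : Gl2HC) (i j : Fin 2) :
    vmat (c • X) i j = algebraMap ℂ Sh c * vmat X i j := by
  simp only [vmat_entry, Matrix.smul_apply, smul_eq_mul, map_mul]
  ring

theorem mult_add (X Y : Gl2HC) : mult (X + Y) = mult X + mult Y := by
  simp only [mult_entry, Matrix.add_apply, map_add]
  ring

theorem mult_smul (c : ℂ) (X : Gl2HC) : mult (c • X) = algebraMap ℂ Sh c * mult X := by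
  simp only [mult_entry, Matrix.smul_apply, smul_eq_mul, map_mul]
  ring

theorem vecField_add (X Y : Gl2HC) : vecField (X + Y) = vecField X + vecField Y := by
  apply derivation_ext
  intro i j
  simp only [Derivation.add_apply, vecField_coord, vmat_add]

theorem vecField_smul (c : ℂ) (X : Gl2HC) : vecField (c • X) = c • vecField X := by
  apply derivation_ext
  intro i j
  simp only [Derivation.smul_apply, vecField_coord, vmat_smul]
  rw [Algebra.smul_def]

/-- The space of polynomial functions as a module over `gl(2, ℍ_ℂ)`, through the differentiated
action `ρ`. -/
instance instLieRingModuleSh : LieRingModule Gl2HC Sh where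
  bracket X f := ⟨rhoLie X f, rhoLie_mem X f⟩
  add_lie X Y f := Subtype.ext (by
    change rhoLie (X + Y) f = rhoLie X f + rhoLie Y f
    simp only [rhoLie_eq, vecField_add, mult_add, Derivation.add_apply]
    rw [← Subalgebra.coe_add]
    congr 1
    ring)
  lie_add X f g := Subtype.ext (by
    change rhoLie X (f + g : Sh) = rhoLie X f + rhoLie X g
    simp only [rhoLie_eq, map_add]
    rw [← Subalgebra.coe_add]
    congr 1
    ring)
  leibniz_lie X Y f := by
    have key : ∀ (X : Gl2HC) (f : Sh), (⟨rhoLie X f, rhoLie_mem X f⟩ : Sh) =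
        vecField X f + mult X * f := fun X f => Subtype.ext (rhoLie_eq X f)
    change (⟨rhoLie X (⟨rhoLie Y f, rhoLie_mem Y f⟩ : Sh), rhoLie_mem X _⟩ : Sh) =
      ⟨rhoLie ⁅X, Y⁆ f, rhoLie_mem _ f⟩ +
        ⟨rhoLie Y (⟨rhoLie X f, rhoLie_mem X f⟩ : Sh), rhoLie_mem Y _⟩
    rw [key Y f, key X f, key, key, key, vecField_lie, mult_lie, Derivation.commutator_apply]
    simp only [map_add, Derivation.leibniz, smul_eq_mul]
    ring

theorem lie_def (X : Gl2HC) (f : Sh) : ⁅X, f⁆ = ⟨rhoLie X f, rhoLie_mem X f⟩ := rfl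

/-- The explicit form of the action. -/
theorem lie_eq (X : Gl2HC) (f : Sh) : ⁅X, f⁆ = vecField X f + mult X * f :=
  Subtype.ext (rhoLie_eq X f)

instance instLieModuleSh : LieModule ℂ Gl2HC Sh where
  smul_lie c X f := by
    simp only [lie_eq, vecField_smul, mult_smul, Derivation.smul_apply, smul_add]
    simp only [Algebra.smul_def (A := Sh)]
    ring
  lie_smul c X f := by
    simp only [lie_eq, Derivation.map_smul, smul_add]
    simp only [Algebra.smul_def (A := Sh)]
    ring

/-! ### Matrix coefficients -/

/-- The matrix coefficient `t^l_{n m}(Z)` of `SU(2)`, where `L = 2l`, `p = l - m`, `q = l - n`, so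
that `l` runs over `0, 1/2, 1, ...` and `m, n ∈ ℤ + l` with `-l ≤ m, n ≤ l`:
`(2πi)⁻¹ ∮ (s z₁₁ + z₂₁)^(l-m) (s z₁₂ + z₂₂)^(l+m) s^(-l+n) ds/s`, the integral being taken
counterclockwise over the unit circle. -/
def tFun (L : ℕ) (p q : Fin (L + 1)) (Z : HC) : ℂ :=
  (2 * (Real.pi : ℂ) * Complex.I)⁻¹ *
    ∮ s in C(0, 1), (s * Z 0 0 + Z 1 0) ^ (p : ℕ) * (s * Z 0 1 + Z 1 1) ^ (L - p : ℕ) *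
      s ^ (-(q : ℤ)) * s⁻¹

theorem circleIntegral_poly (P : Polynomial ℂ) (q : ℕ) :
    (2 * (Real.pi : ℂ) * Complex.I)⁻¹ * ∮ s in C(0, 1), P.eval s * s ^ (-(q : ℤ)) * s⁻¹ =
      P.coeff q := by
  have hI : (2 * (Real.pi : ℂ) * Complex.I) ≠ 0 := Complex.two_pi_I_ne_zero
  have hterm : ∀ n : ℤ, ∀ c : ℂ, CircleIntegrable (fun s : ℂ => c * s ^ n) 0 1 := by
    intro n c
    have h := (circleIntegrable_sub_zpow_iff (c := 0) (w := 0) (R := 1) (n := n)).2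
      (Or.inr (Or.inr (by simp)))
    have h2 := h.const_smul (a := c)
    simp only [sub_zero] at h2
    exact h2
  have h1 : (∮ s in C(0, 1), P.eval s * s ^ (-(q : ℤ)) * s⁻¹) =
      ∮ s in C(0, 1), ∑ k ∈ P.support, P.coeff k * s ^ ((k : ℤ) - q - 1) := by
    refine circleIntegral.integral_congr zero_le_one ?_
    intro s hs
    have hs0 : s ≠ 0 := by
      rintro rfl
      simp at hs
    simp only [Polynomial.eval_eq_sum, Polynomial.sum, Finset.sum_mul]
    refine Finset.sum_congr rfl fun k _ => ?_
    rw [zpow_sub₀ hs0, zpow_sub₀ hs0, _root_.zpow_neg, zpow_natCast, zpow_natCast, zpow_one]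
    field_simp
  rw [h1, circleIntegral.integral_fun_sum (fun k _ => hterm _ _)]
  have h2 : ∀ k ∈ P.support, (∮ s in C(0, 1), P.coeff k * s ^ ((k : ℤ) - q - 1)) =
      if k = q then P.coeff k * (2 * (Real.pi : ℂ) * Complex.I) else 0 := by
    intro k _
    rw [circleIntegral.integral_const_mul]
    split_ifs with h
    · have := circleIntegral.integral_sub_center_inv (0 : ℂ) (R := 1) one_ne_zero
      simp only [sub_zero] at this
      rw [h, sub_self, zero_sub, ← this]
      simp only [_root_.zpow_neg_one]
    · have := circleIntegral.integral_sub_zpow_of_ne (n := (k : ℤ) - q - 1) (by omega) 0 0 1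
      simp only [sub_zero] at this
      rw [this, mul_zero]
  rw [Finset.sum_congr rfl h2, Finset.sum_ite_eq']
  split_ifs with h
  · field_simp
  · rw [Polynomial.notMem_support_iff.1 h, mul_zero]

open Polynomial in
/-- `(s z₁₁ + z₂₁)^(l-m) (s z₁₂ + z₂₂)^(l+m)` as a polynomial in `s`. -/
def tPoly (L p : ℕ) : Polynomial Sh :=
  (X * C (coord 0 0) + C (coord 1 0)) ^ p * (X * C (coord 0 1) + C (coord 1 1)) ^ (L - p)

/-- Evaluation at a point. -/
def evalAt (Z : HCˣ) : Sh →+* ℂ := (Pi.evalRingHom (fun _ : HCˣ => ℂ) Z).comp Sh.val.toRingHom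

theorem tFun_eq_coeff (L : ℕ) (p q : Fin (L + 1)) (Z : HCˣ) :
    tFun L p q Z.val = ((tPoly L p).coeff q : Sh).val Z := by
  have h := circleIntegral_poly ((tPoly L p).map (evalAt Z)) q
  rw [Polynomial.coeff_map] at h
  refine Eq.trans ?_ h
  have h1 : ∀ i j, evalAt Z (coord i j) = Z.val i j := fun _ _ => rfl
  have h2 : ∀ s, ((tPoly L p).map (evalAt Z)).eval s =
      (s * Z.val 0 0 + Z.val 1 0) ^ (p : ℕ) * (s * Z.val 0 1 + Z.val 1 1) ^ (L - p : ℕ) := by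
    intro s
    simp only [tPoly, Polynomial.map_mul, Polynomial.map_pow, Polynomial.map_add, Polynomial.map_X,
      Polynomial.map_C, Polynomial.eval_mul, Polynomial.eval_pow, Polynomial.eval_add,
      Polynomial.eval_X, Polynomial.eval_C, h1]
  simp only [tFun, h2]

theorem detZpow_mem (k : ℤ) : (fun Z : HCˣ => Z.val.det ^ k) ∈ Sh := by
  obtain ⟨n, rfl | rfl⟩ := k.eq_nat_or_neg
  · have := pow_mem det_mem n
    convert this using 1
    funext Z
    simp
  · have := pow_mem detInv_mem n
    convert this using 1
    funext Z
    simp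

theorem kType_mem (k : ℤ) (L : ℕ) (p q : Fin (L + 1)) :
    (fun Z : HCˣ => Z.val.det ^ k * tFun L p q Z.val) ∈ Sh := by
  have h : (fun Z : HCˣ => tFun L p q Z.val) = ((tPoly L p).coeff q : Sh).val :=
    funext fun Z => tFun_eq_coeff L p q Z
  have h2 : (fun Z : HCˣ => tFun L p q Z.val) ∈ Sh := h ▸ Subtype.property _
  exact mul_mem (detZpow_mem k) h2

/-- The function `N(Z)^k t^l_{n m}(Z)`, where `L = 2l`, `p = l - m`, `q = l - n`. -/
def kType (k : ℤ) (L : ℕ) (p q : Fin (L + 1)) : Sh := ⟨_, kType_mem k L p q⟩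

/-- The span of all functions `N(Z)^k t^l_{n m}(Z)` for which `k` and `2l` satisfy the condition
`P k (2l)`. -/
def spanK (P : ℤ → ℤ → Prop) : Submodule ℂ Sh :=
  Submodule.span ℂ {f | ∃ (k : ℤ) (L : ℕ) (p q : Fin (L + 1)), P k L ∧ f = kType k L p q}

/-- The representation `V/U` for invariant subspaces `U ⊆ V` (in general, `V/(U ∩ V)`). -/
abbrev Subquot (V U : LieSubmodule ℂ Gl2HC Sh) : Type := V ⧸ U.comap V.incl

end Biquaternion
end

noncomputable section

namespace Biquaternion

open Matrix

/-! Write `L = 2l` and attach to the K-type spanned by the functions `N(Z)^k t^l_{n m}(Z)` the pair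
`x = k + L + 1`, `y = k`; K-types are then the integer points with `y < x`. The K-type functions
form a basis of `Sh` (`span_basisVec`, `linearIndependent_basisVec`). The block-diagonal part of the
Lie algebra preserves each K-type, connects all its basis vectors by ladder operators, and supplies
commuting eigenvalues that separate the basis. Hence an invariant subspace is the span of the
K-types it contains (`toSubmodule_eq_spanK`), and everything becomes combinatorics of points `(x,
y)`.

The upper right block differentiates and the lower left block raises degrees. By the Clebsch-Gordan
rule for `z_ij t^l` the former sends `(x, y)` to `(x - 1, y)` and `(x, y - 1)` with coefficients
proportional to `x` and `y`; the latter sends it to `(x + 1, y)` and `(x, y + 1)` with coefficients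
proportional to `x + 3` and `y + 3` (`lie_lowering`, `lie_raising`). So both coordinates obey the
same rule: every unit step inside `y < x` is possible except `0 → -1` and `-3 → -2`.

Each coordinate therefore has three zones, `≤ -3`, `{-2, -1}` and `≥ 0`; the middle zone can be left
but never entered. The condition `y < x` leaves six pairs of zones, which are the six components:
both `≥ 0` is `Sh⁺`, both `≤ -3` is `Sh⁻`, `x ≥ 0` with `y ≤ -3` is `J`, one middle coordinate gives
the quotients of `I⁺` and `I⁻`, and both middle is the single point `N(Z)⁻²`. Any point of a zone
pair reaches that whole pair and everything below it (`IsKClosed.reach`). This yields the invariant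
subspaces, their covering relations and, through the second isomorphism theorem, the identification
of every irreducible subquotient (`IsLocalPair.nonempty_equiv`). -/

instance instIsRightCancelAddPolynomialSh : IsRightCancelAdd (Polynomial Sh) :=
  ⟨fun _ _ _ h => Polynomial.ext fun n => by
    have h1 := congrArg (fun P : Polynomial Sh => P.coeff n) h
    simp only [Polynomial.coeff_add] at h1
    exact add_right_cancel h1⟩

/-! ### Derivations on coefficients of polynomials -/

/-- `Q` is obtained from `P` by applying the derivation `D` to all coefficients. -/
def CoeffDeriv (D : Derivation ℂ Sh Sh) (P Q : Polynomial Sh) : Prop :=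
  ∀ n, D (P.coeff n) = Q.coeff n

theorem CoeffDeriv.mul {D : Derivation ℂ Sh Sh} {P Q P' Q' : Polynomial Sh}
    (h : CoeffDeriv D P Q) (h' : CoeffDeriv D P' Q') :
    CoeffDeriv D (P * P') (P * Q' + P' * Q) := by
  intro n
  rw [Polynomial.coeff_add, mul_comm P' Q]
  simp only [Polynomial.coeff_mul, map_sum, Derivation.leibniz, smul_eq_mul,
    ← Finset.sum_add_distrib, h _, h' _]
  exact Finset.sum_congr rfl fun _ _ => by ring

theorem CoeffDeriv.pow {D : Derivation ℂ Sh Sh} {P Q : Polynomial Sh}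
    (h : CoeffDeriv D P Q) (n : ℕ) : CoeffDeriv D (P ^ n) (n * P ^ (n - 1) * Q) := by
  induction n with
  | zero =>
    intro m
    simp [Polynomial.coeff_one, apply_ite D]
  | succ n ih =>
    have h1 := ih.mul h
    rw [← pow_succ] at h1
    convert h1 using 1
    rcases n with _ | n
    · simp
    · simp only [Nat.add_sub_cancel]
      push_cast
      ring

/-- The linear form `s z_{1j} + z_{2j}`. -/
def linForm (j : Fin 2) : Polynomial Sh :=
  Polynomial.X * Polynomial.C (coord 0 j) + Polynomial.C (coord 1 j)

theorem linForm_coeffDeriv (D : Derivation ℂ Sh Sh) (j : Fin 2) :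
    CoeffDeriv D (linForm j)
      (Polynomial.X * Polynomial.C (D (coord 0 j)) + Polynomial.C (D (coord 1 j))) := by
  intro n
  rcases n with _ | n
  · simp [linForm]
  · rcases n with _ | n <;> simp [linForm, Polynomial.coeff_C]

/-- `(s z₁₁ + z₂₁)^p (s z₁₂ + z₂₂)^r` as a polynomial in `s`. -/
def linPow (p r : ℕ) : Polynomial Sh := linForm 0 ^ p * linForm 1 ^ r

/-- The truncated exponents `p - 1` and `r - 1` are harmless: at `0` the numerical factor in front
vanishes. -/
theorem linPow_coeffDeriv (D : Derivation ℂ Sh Sh) (p r : ℕ) :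
    CoeffDeriv D (linPow p r)
      ((p : Polynomial Sh) * linPow (p - 1) r *
          (Polynomial.X * Polynomial.C (D (coord 0 0)) + Polynomial.C (D (coord 1 0))) +
        (r : Polynomial Sh) * linPow p (r - 1) *
          (Polynomial.X * Polynomial.C (D (coord 0 1)) + Polynomial.C (D (coord 1 1)))) := by
  have h := ((linForm_coeffDeriv D 0).pow p).mul ((linForm_coeffDeriv D 1).pow r)
  refine Eq.subst (motive := CoeffDeriv D (linPow p r)) ?_ h
  unfold linPow
  ring

theorem linPow_succ_left (p r : ℕ) : linPow (p + 1) r = linForm 0 * linPow p r := by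
  simp only [linPow]; ring

theorem linPow_succ_right (p r : ℕ) : linPow p (r + 1) = linForm 1 * linPow p r := by
  simp only [linPow]; ring

theorem linForm_derivative (j : Fin 2) :
    Polynomial.derivative (linForm j) = Polynomial.C (coord 0 j) := by
  simp [linForm]

theorem linPow_derivative (p r : ℕ) :
    Polynomial.derivative (linPow p r) =
      (p : Polynomial Sh) * linPow (p - 1) r * Polynomial.C (coord 0 0) +
        (r : Polynomial Sh) * linPow p (r - 1) * Polynomial.C (coord 0 1) := by
  simp only [linPow, Polynomial.derivative_mul, Polynomial.derivative_pow, linForm_derivative,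
    map_natCast]
  ring

/-- Euler's relation in one linear form, kept multiplied by `p` so that it also covers `p = 0`. -/
theorem linPow_pred_left (p r : ℕ) : (p : Polynomial Sh) * (linPow (p - 1) r * linForm 0) =
    p * linPow p r := by
  rcases p with _ | p
  · simp
  · rw [Nat.add_sub_cancel, linPow_succ_left]; ring

theorem linPow_pred_right (p r : ℕ) : (r : Polynomial Sh) * (linPow p (r - 1) * linForm 1) =
    r * linPow p r := by
  rcases r with _ | r
  · simp
  · rw [Nat.add_sub_cancel, linPow_succ_right]; ring

/-! ### Powers of the norm -/

/-- The norm `N(Z)` as an element of `Sh`. -/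
def nrm : Sh := coord 0 0 * coord 1 1 - coord 0 1 * coord 1 0

/-- Eliminating `s` between the two linear forms leaves the determinant. This is the source of every
shift of `k` in the Clebsch-Gordan formulas. -/
theorem linForm_norm :
    Polynomial.C (coord 0 0) * linForm 1 - Polynomial.C (coord 0 1) * linForm 0 =
      Polynomial.C nrm := by
  simp only [linForm, nrm, map_sub, map_mul]
  ring

/-- The power `N(Z)^k`. -/
def normPow (k : ℤ) : Sh := ⟨_, detZpow_mem k⟩

theorem norm_coe (Z : HCˣ) : nrm.val Z = Z.val.det := by
  simp [nrm, coord, Matrix.det_fin_two]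

theorem normPow_add (k l : ℤ) : normPow (k + l) = normPow k * normPow l :=
  Subtype.ext (funext fun Z => zpow_add₀ (det_ne_zero Z) k l)

theorem normPow_zero : normPow 0 = 1 :=
  Subtype.ext (funext fun _ => zpow_zero _)

theorem normPow_one : normPow 1 = nrm :=
  Subtype.ext (funext fun Z => (zpow_one _).trans (norm_coe Z).symm)

theorem normPow_neg_one : normPow (-1) = detInv :=
  Subtype.ext (funext fun _ => _root_.zpow_neg_one _)

theorem normPow_succ (k : ℤ) : normPow (k + 1) = normPow k * nrm := by
  rw [normPow_add, normPow_one]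

theorem normPow_pred (k : ℤ) : normPow (k - 1) = normPow k * detInv := by
  rw [sub_eq_add_neg, normPow_add, normPow_neg_one]

theorem norm_mul_detInv : nrm * detInv = 1 := by
  rw [← normPow_one, ← normPow_neg_one, ← normPow_add, ← normPow_zero]; rfl

theorem coord_mul_detInv :
    (coord 0 0 * coord 1 1 - coord 0 1 * coord 1 0) * detInv = 1 := norm_mul_detInv

theorem derivation_detInv (D : Derivation ℂ Sh Sh) : D detInv = -(detInv * detInv * D nrm) := by
  rw [Derivation.leibniz_of_mul_eq_one D ((mul_comm _ _).trans norm_mul_detInv)]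
  simp only [smul_eq_mul]
  ring

/-- Induction runs in both directions from `k = 0`; writing `N⁻¹` as `detInv` gives one formula for
all integers. -/
theorem derivation_normPow (D : Derivation ℂ Sh Sh) (k : ℤ) :
    D (normPow k) = (k : Sh) * (normPow k * (detInv * D nrm)) := by
  induction k with
  | zero => rw [normPow_zero]; simp
  | succ k ih =>
    rw [normPow_succ, D.leibniz, ih]
    simp only [smul_eq_mul]
    push_cast
    linear_combination normPow k * D nrm * (-1) * norm_mul_detInv
  | pred k ih =>
    rw [normPow_pred, D.leibniz, ih, derivation_detInv]
    simp only [smul_eq_mul]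
    push_cast
    ring

/-! ### Reduction of the action to polynomial identities -/

/-- The function `N(Z)^k t^l_{n m}(Z)`, where `p = l - m`, `r = l + m`, `q = l - n`. -/
def kVec (k : ℤ) (p r q : ℕ) : Sh := normPow k * (linPow p r).coeff q

theorem kType_eq (k : ℤ) (L : ℕ) (p q : Fin (L + 1)) :
    kType k L p q = kVec k p (L - p) q := by
  apply Subtype.ext
  funext Z
  change Z.val.det ^ k * tFun L p q Z.val = _
  rw [tFun_eq_coeff]
  rfl

/-- By the Leibniz rule the derivative of `N^k` merges with the multiplier into the function `c`,
while differentiating the two linear forms gives `Q`. For each matrix unit only the two identities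
`hc` and `hQ` remain to be checked. -/
theorem lie_kVec {X : Gl2HC} {k : ℤ} {p r : ℕ} (q : ℕ) {c : Sh} {Q : Polynomial Sh}
    (hc : mult X + k * (detInv * vecField X nrm) = c)
    (hQ : (p : Polynomial Sh) * linPow (p - 1) r *
          (Polynomial.X * Polynomial.C (vmat X 0 0) + Polynomial.C (vmat X 1 0)) +
        (r : Polynomial Sh) * linPow p (r - 1) *
          (Polynomial.X * Polynomial.C (vmat X 0 1) + Polynomial.C (vmat X 1 1)) = Q) :
    ⁅X, kVec k p r q⁆ = normPow k * (c * (linPow p r).coeff q + Q.coeff q) := by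
  have h := linPow_coeffDeriv (vecField X) p r q
  simp only [vecField_coord] at h
  rw [← hc, ← hQ, ← h, lie_eq, kVec, Derivation.leibniz, derivation_normPow]
  simp only [smul_eq_mul]
  ring

/-- The matrix units of `gl(2, ℍ_ℂ)`. -/
def gUnit (a b i j : Fin 2) : Gl2HC := Matrix.single a b (Matrix.single i j 1)

theorem gUnit_entry (a b i j a' b' i' j' : Fin 2) :
    gUnit a b i j a' b' i' j' = if a = a' ∧ b = b' ∧ i = i' ∧ j = j' then 1 else 0 := by
  simp only [gUnit, Matrix.single_apply]
  by_cases h : a = a' ∧ b = b'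
  · simp [h, Matrix.single_apply]
  · rw [if_neg h, if_neg (fun h' => h ⟨h'.1, h'.2.1⟩)]; rfl

theorem vecField_norm (X : Gl2HC) : vecField X nrm =
    coord 0 0 * vmat X 1 1 + coord 1 1 * vmat X 0 0 -
      (coord 0 1 * vmat X 1 0 + coord 1 0 * vmat X 0 1) := by
  simp only [nrm, map_sub, Derivation.leibniz, vecField_coord, smul_eq_mul]

theorem coeff_X_mul_derivative (P : Polynomial Sh) (q : ℕ) :
    (Polynomial.X * Polynomial.derivative P).coeff q = q * P.coeff q := by
  rcases q with _ | q
  · simp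
  · rw [Polynomial.coeff_X_mul, Polynomial.coeff_derivative]
    push_cast
    ring

theorem coeff_natCast_mul (n : ℕ) (P : Polynomial Sh) (q : ℕ) :
    ((n : Polynomial Sh) * P).coeff q = n * P.coeff q := by
  rw [← Polynomial.C_eq_natCast, Polynomial.coeff_C_mul]

/-! ### Action of the block-diagonal part -/

section Action

variable (k : ℤ) (p r q : ℕ)

/-- On polynomials in `s`, with `L = p + r`, the upper left block acts by the `sl(2)`-type operators
`-s d/ds`, `s d/ds - L`, `-d/ds` and `s (s d/ds - L)`, up to the scalar `-(k + 2)` for the diagonal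
units. It changes only `q`. -/
theorem lie_rowDiag_zero :
    ⁅gUnit 0 0 0 0, kVec k p r q⁆ = (-(q + k + 2 : ℂ)) • kVec k p r q := by
  rw [lie_kVec (c := -(2 + k)) (Q := -(Polynomial.X * Polynomial.derivative (linPow p r))) q]
  · rw [Polynomial.coeff_neg, coeff_X_mul_derivative, kVec, Algebra.smul_def]
    simp only [map_neg, map_add, map_natCast, map_intCast, map_ofNat]
    ring
  · simp [vecField_norm, vmat_entry, mult_entry, gUnit_entry]
    linear_combination (-k : Sh) * coord_mul_detInv
  · simp [vmat_entry, gUnit_entry, linPow_derivative]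
    ring

theorem lie_rowDiag_one :
    ⁅gUnit 0 0 1 1, kVec k p r q⁆ = (-(p + r - q + k + 2 : ℂ)) • kVec k p r q := by
  rw [lie_kVec (c := -(2 + k)) (Q := -(((p + r : ℕ) : Polynomial Sh) * linPow p r) +
    Polynomial.X * Polynomial.derivative (linPow p r)) q]
  · rw [Polynomial.coeff_add, Polynomial.coeff_neg, coeff_X_mul_derivative, coeff_natCast_mul,
      kVec, Algebra.smul_def]
    simp only [map_neg, map_add, map_sub, map_natCast, map_intCast, map_ofNat]
    push_cast
    ring
  · simp [vecField_norm, vmat_entry, mult_entry, gUnit_entry]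
    linear_combination (-k : Sh) * coord_mul_detInv
  · have h1 := linPow_pred_left p r
    have h2 := linPow_pred_right p r
    rw [linForm] at h1 h2
    simp [vmat_entry, gUnit_entry, linPow_derivative]
    linear_combination -h1 - h2

theorem lie_rowRaise :
    ⁅gUnit 0 0 1 0, kVec k p r q⁆ = (-(q + 1 : ℂ)) • kVec k p r (q + 1) := by
  rw [lie_kVec (c := 0) (Q := -Polynomial.derivative (linPow p r)) q]
  · rw [Polynomial.coeff_neg, Polynomial.coeff_derivative, kVec, Algebra.smul_def]
    simp only [map_neg, map_add, map_natCast, map_one]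
    ring
  · simp [vecField_norm, vmat_entry, mult_entry, gUnit_entry]
    ring
  · simp [vmat_entry, gUnit_entry, linPow_derivative]
    ring

theorem lie_rowLower_aux :
    ⁅gUnit 0 0 0 1, kVec k p r q⁆ = normPow k * (Polynomial.X * (-(((p + r : ℕ) : Polynomial Sh) * linPow p r) +
      Polynomial.X * Polynomial.derivative (linPow p r))).coeff q := by
  rw [lie_kVec (c := 0) (Q := Polynomial.X * (-(((p + r : ℕ) : Polynomial Sh) * linPow p r) +
    Polynomial.X * Polynomial.derivative (linPow p r))) q]
  · ring
  · simp [vecField_norm, vmat_entry, mult_entry, gUnit_entry]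
    ring
  · have h1 := linPow_pred_left p r
    have h2 := linPow_pred_right p r
    rw [linForm] at h1 h2
    simp [vmat_entry, gUnit_entry, linPow_derivative]
    linear_combination -Polynomial.X * h1 - Polynomial.X * h2

theorem lie_rowLower_zero : ⁅gUnit 0 0 0 1, kVec k p r 0⁆ = 0 := by
  rw [lie_rowLower_aux]
  simp

theorem lie_rowLower_succ :
    ⁅gUnit 0 0 0 1, kVec k p r (q + 1)⁆ = (-(p + r - q : ℂ)) • kVec k p r q := by
  rw [lie_rowLower_aux, Polynomial.coeff_X_mul, Polynomial.coeff_add, Polynomial.coeff_neg,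
    coeff_X_mul_derivative, coeff_natCast_mul, kVec, Algebra.smul_def]
  simp only [map_neg, map_add, map_sub, map_natCast]
  push_cast
  ring

/-- Right multiplication acts on the columns of `Z`, hence replaces one linear form by another. The
lower right block therefore changes only `p` and `r`, with their sum fixed. -/
theorem lie_colDiag_zero :
    ⁅gUnit 1 1 0 0, kVec k p r q⁆ = (p + k + 2 : ℂ) • kVec k p r q := by
  rw [lie_kVec (c := 2 + k) (Q := p * linPow p r) q]
  · rw [coeff_natCast_mul, kVec, Algebra.smul_def]
    simp only [map_add, map_natCast, map_intCast, map_ofNat]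
    ring
  · simp [vecField_norm, vmat_entry, mult_entry, gUnit_entry]
    linear_combination (k : Sh) * coord_mul_detInv
  · have h1 := linPow_pred_left p r
    rw [linForm] at h1
    simp [vmat_entry, gUnit_entry]
    linear_combination h1

theorem lie_colDiag_one :
    ⁅gUnit 1 1 1 1, kVec k p r q⁆ = (r + k + 2 : ℂ) • kVec k p r q := by
  rw [lie_kVec (c := 2 + k) (Q := r * linPow p r) q]
  · rw [coeff_natCast_mul, kVec, Algebra.smul_def]
    simp only [map_add, map_natCast, map_intCast, map_ofNat]
    ring
  · simp [vecField_norm, vmat_entry, mult_entry, gUnit_entry]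
    linear_combination (k : Sh) * coord_mul_detInv
  · have h1 := linPow_pred_right p r
    rw [linForm] at h1
    simp [vmat_entry, gUnit_entry]
    linear_combination h1

theorem lie_colRaise :
    ⁅gUnit 1 1 0 1, kVec k p r q⁆ = (r : ℂ) • kVec k (p + 1) (r - 1) q := by
  rw [lie_kVec (c := 0) (Q := r * linPow (p + 1) (r - 1)) q]
  · rw [coeff_natCast_mul, kVec, Algebra.smul_def]
    simp only [map_natCast]
    ring
  · simp [vecField_norm, vmat_entry, mult_entry, gUnit_entry]
    ring
  · rw [linPow_succ_left, linForm]
    simp [vmat_entry, gUnit_entry]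
    ring

theorem lie_colLower :
    ⁅gUnit 1 1 1 0, kVec k p r q⁆ = (p : ℂ) • kVec k (p - 1) (r + 1) q := by
  rw [lie_kVec (c := 0) (Q := p * linPow (p - 1) (r + 1)) q]
  · rw [coeff_natCast_mul, kVec, Algebra.smul_def]
    simp only [map_natCast]
    ring
  · simp [vecField_norm, vmat_entry, mult_entry, gUnit_entry]
    ring
  · rw [linPow_succ_right, linForm]
    simp [vmat_entry, gUnit_entry]
    ring

/-! The Clebsch-Gordan decomposition of the products `z_ij t^l_{n m}`. -/

/-- In the derivative of `linPow (p + 1) r`, `linForm_norm` replaces `z₁₂ · linForm 0` by `z₁₁ ·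
linForm 1 - N`; the terms with `z₁₁` then add up to `p + r + 1` copies. -/
theorem coord_mul_linPow_zero_zero :
    ((p + r + 1 : ℕ) : Polynomial Sh) * (Polynomial.C (coord 0 0) * linPow p r) =
      Polynomial.derivative (linPow (p + 1) r) +
        (r : Polynomial Sh) * (Polynomial.C nrm * linPow p (r - 1)) := by
  rw [linPow_derivative, ← linForm_norm, linPow_succ_left, Nat.add_sub_cancel]
  push_cast
  linear_combination -Polynomial.C (coord 0 0) * linPow_pred_right p r

theorem coord_mul_linPow_zero_one :
    ((p + r + 1 : ℕ) : Polynomial Sh) * (Polynomial.C (coord 0 1) * linPow p r) =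
      Polynomial.derivative (linPow p (r + 1)) -
        (p : Polynomial Sh) * (Polynomial.C nrm * linPow (p - 1) r) := by
  rw [linPow_derivative, ← linForm_norm, linPow_succ_right, Nat.add_sub_cancel]
  push_cast
  linear_combination -Polynomial.C (coord 0 1) * linPow_pred_left p r

/-- The second row reduces to the first through `z₂₁ = linForm 0 - s z₁₁`. -/
theorem coord_mul_linPow_one_zero :
    ((p + r + 1 : ℕ) : Polynomial Sh) * (Polynomial.C (coord 1 0) * linPow p r) =
      ((p + r + 1 : ℕ) : Polynomial Sh) * linPow (p + 1) r - Polynomial.X *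
        (Polynomial.derivative (linPow (p + 1) r) +
          (r : Polynomial Sh) * (Polynomial.C nrm * linPow p (r - 1))) := by
  rw [← coord_mul_linPow_zero_zero, linPow_succ_left, linForm]
  ring

theorem coord_mul_linPow_one_one :
    ((p + r + 1 : ℕ) : Polynomial Sh) * (Polynomial.C (coord 1 1) * linPow p r) =
      ((p + r + 1 : ℕ) : Polynomial Sh) * linPow p (r + 1) - Polynomial.X *
        (Polynomial.derivative (linPow p (r + 1)) -
          (p : Polynomial Sh) * (Polynomial.C nrm * linPow (p - 1) r)) := by
  rw [← coord_mul_linPow_zero_one, linPow_succ_right, linForm]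
  ring

theorem coord_mul_kVec_zero_zero :
    (p + r + 1 : ℂ) • (coord 0 0 * kVec k p r q) =
      (q + 1 : ℂ) • kVec k (p + 1) r (q + 1) + (r : ℂ) • kVec (k + 1) p (r - 1) q := by
  have h := congrArg (fun P : Polynomial Sh => P.coeff q) (coord_mul_linPow_zero_zero p r)
  simp only [coeff_natCast_mul, Polynomial.coeff_C_mul, Polynomial.coeff_add,
    Polynomial.coeff_derivative] at h
  simp only [kVec, normPow_succ, Algebra.smul_def, map_add, map_natCast, map_one]
  push_cast at h
  linear_combination normPow k * h

theorem coord_mul_kVec_zero_one :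
    (p + r + 1 : ℂ) • (coord 0 1 * kVec k p r q) =
      (q + 1 : ℂ) • kVec k p (r + 1) (q + 1) - (p : ℂ) • kVec (k + 1) (p - 1) r q := by
  have h := congrArg (fun P : Polynomial Sh => P.coeff q) (coord_mul_linPow_zero_one p r)
  simp only [coeff_natCast_mul, Polynomial.coeff_C_mul, Polynomial.coeff_sub,
    Polynomial.coeff_derivative] at h
  simp only [kVec, normPow_succ, Algebra.smul_def, map_add, map_natCast, map_one]
  push_cast at h
  linear_combination normPow k * h

theorem coord_mul_kVec_one_zero_zero :
    coord 1 0 * kVec k p r 0 = kVec k (p + 1) r 0 := by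
  simp only [kVec, linPow_succ_left, Polynomial.mul_coeff_zero]
  simp [linForm]
  ring

theorem coord_mul_kVec_one_zero_succ :
    (p + r + 1 : ℂ) • (coord 1 0 * kVec k p r (q + 1)) =
      (p + r - q : ℂ) • kVec k (p + 1) r (q + 1) - (r : ℂ) • kVec (k + 1) p (r - 1) q := by
  have h := congrArg (fun P : Polynomial Sh => P.coeff (q + 1)) (coord_mul_linPow_one_zero p r)
  simp only [coeff_natCast_mul, Polynomial.coeff_C_mul, Polynomial.coeff_sub,
    Polynomial.coeff_X_mul, Polynomial.coeff_add, Polynomial.coeff_derivative] at h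
  simp only [kVec, normPow_succ, Algebra.smul_def, map_add, map_sub, map_natCast, map_one]
  push_cast at h
  linear_combination normPow k * h

theorem coord_mul_kVec_one_one_zero :
    coord 1 1 * kVec k p r 0 = kVec k p (r + 1) 0 := by
  simp only [kVec, linPow_succ_right, Polynomial.mul_coeff_zero]
  simp [linForm]
  ring

theorem coord_mul_kVec_one_one_succ :
    (p + r + 1 : ℂ) • (coord 1 1 * kVec k p r (q + 1)) =
      (p + r - q : ℂ) • kVec k p (r + 1) (q + 1) + (p : ℂ) • kVec (k + 1) (p - 1) r q := by
  have h := congrArg (fun P : Polynomial Sh => P.coeff (q + 1)) (coord_mul_linPow_one_one p r)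
  simp only [coeff_natCast_mul, Polynomial.coeff_C_mul, Polynomial.coeff_sub,
    Polynomial.coeff_X_mul, Polynomial.coeff_derivative] at h
  simp only [kVec, normPow_succ, Algebra.smul_def, map_add, map_sub, map_natCast, map_one]
  push_cast at h
  linear_combination normPow k * h

theorem detInv_mul_kVec : detInv * kVec k p r q = kVec (k - 1) p r q := by
  simp only [kVec, normPow_pred]
  ring

/-! The action of the noncompact part. -/

/-- This unit acts as `-∂/∂z₂₂`. Differentiating `N^k` produces `z₁₁ N^(k-1)`, which the
Clebsch-Gordan rule at exponent `k - 1` splits; its second term joins the derivative of `linForm 1 ^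
r`, giving the factor `k + (p + r + 1)`. -/
theorem lie_lowering :
    (p + r + 1 : ℂ) • ⁅gUnit 0 1 1 1, kVec k p r q⁆ =
      (-(k * (q + 1)) : ℂ) • kVec (k - 1) (p + 1) r (q + 1) +
        (-(r * (k + p + r + 1)) : ℂ) • kVec k p (r - 1) q := by
  have h := coord_mul_kVec_zero_zero (k - 1) p r q
  rw [lie_kVec (c := -(k * (detInv * coord 0 0))) (Q := -(r * linPow p (r - 1))) q]
  · rw [sub_add_cancel] at h
    simp only [Polynomial.coeff_neg, coeff_natCast_mul]
    simp only [kVec, normPow_pred, Algebra.smul_def, map_add, map_mul, map_neg, map_natCast,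
      map_intCast, map_one] at h ⊢
    linear_combination (-k : Sh) * h
  · simp [vecField_norm, vmat_entry, mult_entry, gUnit_entry]
    ring
  · simp [vmat_entry, gUnit_entry]
    ring

/-- The multiplier contributes `4 z₁₁` and `N^k` contributes `k z₁₁`; the linear forms contribute
the derivative of `linPow (p + 1) r` minus one `z₁₁`. Splitting the resulting `(k + 3) z₁₁` by
Clebsch-Gordan gives both coefficients. -/
theorem lie_raising :
    (p + r + 1 : ℂ) • ⁅gUnit 1 0 0 0, kVec k p r q⁆ =
      ((k + p + r + 4) * (q + 1) : ℂ) • kVec k (p + 1) r (q + 1) +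
        ((k + 3) * r : ℂ) • kVec (k + 1) p (r - 1) q := by
  have h := coord_mul_kVec_zero_zero k p r q
  rw [lie_kVec (c := (4 + k) * coord 0 0) (Q := Polynomial.derivative (linPow (p + 1) r) -
    Polynomial.C (coord 0 0) * linPow p r) q]
  · simp only [Polynomial.coeff_sub, Polynomial.coeff_C_mul, Polynomial.coeff_derivative]
    simp only [kVec, Algebra.smul_def, map_add, map_mul, map_natCast,
      map_intCast, map_one, map_ofNat] at h ⊢
    linear_combination (k + 3 : Sh) * h
  · simp [vecField_norm, vmat_entry, mult_entry, gUnit_entry]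
    linear_combination (k : Sh) * coord 0 0 * coord_mul_detInv
  · have h1 := linPow_pred_left p r
    rw [linPow_derivative, linPow_succ_left, Nat.add_sub_cancel]
    rw [linForm] at *
    simp [vmat_entry, gUnit_entry]
    linear_combination Polynomial.C (coord 0 0) * h1

/-! ### Nonvanishing of the K-type functions -/

theorem kVec_zero_ne_zero : kVec k p r 0 ≠ 0 := by
  -- At this matrix the norm and both constant terms `z₂₁`, `z₂₂` equal `1`, so the function takes
  -- the value `1`.
  have hZ : IsUnit (!![1, 0; 1, 1] : HC) :=
    (Matrix.isUnit_iff_isUnit_det _).2 (by simp [Matrix.det_fin_two])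
  intro h
  have h1 := congrArg (evalAt hZ.unit) h
  have h2 : ∀ i j, evalAt hZ.unit (coord i j) = (!![1, 0; 1, 1] : HC) i j := fun _ _ => rfl
  have h3 : evalAt hZ.unit (normPow k) = (!![1, 0; 1, 1] : HC).det ^ k := rfl
  rw [kVec, linPow, Polynomial.mul_coeff_zero, Polynomial.coeff_zero_eq_eval_zero,
    Polynomial.coeff_zero_eq_eval_zero, Polynomial.eval_pow, Polynomial.eval_pow] at h1
  simp [linForm, h2, h3, Matrix.det_fin_two] at h1

/-- The row lowering operator descends to `q = 0` with coefficients that do not vanish in this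
range. -/
theorem kVec_ne_zero (hq : q ≤ p + r) : kVec k p r q ≠ 0 := by
  induction q with
  | zero => exact kVec_zero_ne_zero k p r
  | succ q ih =>
    intro h
    have h1 := lie_rowLower_succ k p r q
    rw [h, lie_zero] at h1
    refine ih (by omega) ((smul_eq_zero.1 h1.symm).resolve_left ?_)
    rw [← ne_eq, neg_ne_zero, sub_ne_zero]
    exact_mod_cast (show p + r ≠ q by omega)

end Action

/-! ### The basis of K-types -/

theorem linPow_natDegree_le (p r : ℕ) : (linPow p r).natDegree ≤ p + r := by
  have h : ∀ j, (linForm j).natDegree ≤ 1 := by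
    intro j
    rw [linForm, mul_comm]
    exact Polynomial.natDegree_linear_le
  have h1 := Polynomial.natDegree_pow_le_of_le p (h 0)
  have h2 := Polynomial.natDegree_pow_le_of_le r (h 1)
  simpa [linPow] using Polynomial.natDegree_mul_le_of_le h1 h2

theorem kVec_eq_zero (k : ℤ) {p r q : ℕ} (hq : p + r < q) : kVec k p r q = 0 := by
  rw [kVec, Polynomial.coeff_eq_zero_of_natDegree_lt ((linPow_natDegree_le p r).trans_lt hq),
    mul_zero]

/-- The index set of the basis `N(Z)^k t^l_{n m}(Z)`. -/
@[ext]
structure KIdx where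
  k : ℤ
  p : ℕ
  r : ℕ
  q : ℕ
  hq : q ≤ p + r

/-- The basis `N(Z)^k t^l_{n m}(Z)`. -/
def basisVec (i : KIdx) : Sh := kVec i.k i.p i.r i.q

theorem basisVec_ne_zero (i : KIdx) : basisVec i ≠ 0 := kVec_ne_zero _ _ _ _ i.hq

/-- Lets the formulas be used without tracking `q`: outside the index range the function is zero. -/
theorem kVec_mem_of_basisVec_mem {S : Submodule ℂ Sh} {k : ℤ} {p r q : ℕ}
    (h : ∀ hq : q ≤ p + r, basisVec ⟨k, p, r, q, hq⟩ ∈ S) : kVec k p r q ∈ S := by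
  by_cases hq : q ≤ p + r
  · exact h hq
  · rw [kVec_eq_zero k (not_le.1 hq)]
    exact S.zero_mem

theorem add_add_one_ne_zero (p r : ℕ) : (p + r + 1 : ℂ) ≠ 0 := by
  exact_mod_cast (p + r).succ_ne_zero

theorem coord_mul_kVec_mem {S : Submodule ℂ Sh} (hS : ∀ k p r q, kVec k p r q ∈ S)
    (i j : Fin 2) (k : ℤ) (p r q : ℕ) : coord i j * kVec k p r q ∈ S := by
  have h2 : ∀ i : Fin 2, i = 0 ∨ i = 1 := by decide
  rcases h2 i with rfl | rfl <;> rcases h2 j with rfl | rfl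
  · rw [← S.smul_mem_iff (add_add_one_ne_zero p r), coord_mul_kVec_zero_zero]
    exact S.add_mem (S.smul_mem _ (hS _ _ _ _)) (S.smul_mem _ (hS _ _ _ _))
  · rw [← S.smul_mem_iff (add_add_one_ne_zero p r), coord_mul_kVec_zero_one]
    exact S.sub_mem (S.smul_mem _ (hS _ _ _ _)) (S.smul_mem _ (hS _ _ _ _))
  · rcases q with _ | q
    · rw [coord_mul_kVec_one_zero_zero]
      exact hS _ _ _ _
    · rw [← S.smul_mem_iff (add_add_one_ne_zero p r), coord_mul_kVec_one_zero_succ]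
      exact S.sub_mem (S.smul_mem _ (hS _ _ _ _)) (S.smul_mem _ (hS _ _ _ _))
  · rcases q with _ | q
    · rw [coord_mul_kVec_one_one_zero]
      exact hS _ _ _ _
    · rw [← S.smul_mem_iff (add_add_one_ne_zero p r), coord_mul_kVec_one_one_succ]
      exact S.add_mem (S.smul_mem _ (hS _ _ _ _)) (S.smul_mem _ (hS _ _ _ _))

/-- The span contains `1` and is stable under multiplication by the generators `z_ij`
(Clebsch-Gordan) and `N⁻¹` (shift of `k`), hence under the whole algebra. -/
theorem span_basisVec : Submodule.span ℂ (Set.range basisVec) = ⊤ := by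
  set S := Submodule.span ℂ (Set.range basisVec) with hS
  have hv : ∀ k p r q, kVec k p r q ∈ S := fun k p r q =>
    kVec_mem_of_basisVec_mem fun hq => Submodule.subset_span ⟨_, rfl⟩
  have hmul : ∀ g : Sh, (∀ k p r q, g * kVec k p r q ∈ S) → ∀ f ∈ S, g * f ∈ S := by
    intro g hg f hf
    induction hf using Submodule.span_induction with
    | mem x hx =>
      obtain ⟨i, rfl⟩ := hx
      exact hg _ _ _ _
    | zero => rw [mul_zero]; exact S.zero_mem
    | add x y _ _ hx hy => rw [mul_add]; exact S.add_mem hx hy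
    | smul c x _ hx => rw [mul_smul_comm]; exact S.smul_mem _ hx
  have key : ∀ (f : HCˣ → ℂ) (hf : f ∈ Sh), ∀ g ∈ S, (⟨f, hf⟩ : Sh) * g ∈ S := by
    intro f hf
    induction hf using Algebra.adjoin_induction with
    | mem x hx =>
      rcases hx with ⟨i, j, rfl⟩ | rfl
      · exact hmul (coord i j) (coord_mul_kVec_mem hv i j)
      · refine hmul detInv fun k p r q => ?_
        rw [detInv_mul_kVec]
        exact hv _ _ _ _
    | algebraMap c =>
      intro g hg
      have h := S.smul_mem c hg
      rw [Algebra.smul_def] at h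
      exact h
    | add x y hx hy hx' hy' =>
      intro g hg
      have h : (⟨x + y, add_mem hx hy⟩ : Sh) * g = ⟨x, hx⟩ * g + ⟨y, hy⟩ * g :=
        add_mul (⟨x, hx⟩ : Sh) ⟨y, hy⟩ g
      rw [h]
      exact S.add_mem (hx' g hg) (hy' g hg)
    | mul x y hx hy hx' hy' =>
      intro g hg
      have h : (⟨x * y, mul_mem hx hy⟩ : Sh) * g = ⟨x, hx⟩ * (⟨y, hy⟩ * g) :=
        mul_assoc (⟨x, hx⟩ : Sh) ⟨y, hy⟩ g
      rw [h]
      exact hx' _ (hy' g hg)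
  have h1 : (1 : Sh) ∈ S := by
    have := hv 0 0 0 0
    rwa [kVec, normPow_zero, linPow, pow_zero, pow_zero, mul_one, Polynomial.coeff_one_zero,
      mul_one] at this
  refine eq_top_iff.2 fun f _ => ?_
  have := key f.1 f.2 1 h1
  rwa [mul_one] at this

/-! ### Separation of joint eigenvectors -/

/-- Used twice: with `W = ⊥` it gives linear independence, and for an invariant subspace it gives
the splitting into K-types. -/
theorem mem_of_sum_mem_of_eigen {ι κ V : Type*} [AddCommGroup V] [Module ℂ V]
    {W : Submodule ℂ V} (T : κ → V →ₗ[ℂ] V) (hW : ∀ a, ∀ f ∈ W, T a f ∈ W) (v : ι → V)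
    (χ : κ → ι → ℂ) (hT : ∀ a i, T a (v i) = χ a i • v i)
    (hχ : ∀ i j, (∀ a, χ a i = χ a j) → i = j) (s : Finset ι) :
    ∀ c : ι → ℂ, ∑ i ∈ s, c i • v i ∈ W → ∀ i ∈ s, c i • v i ∈ W := by
  classical
  induction s using Finset.strongInduction with
  | H s ih =>
    intro c hs i hi
    by_cases h : ∃ j ∈ s, j ≠ i
    · obtain ⟨j, hj, hji⟩ := h
      obtain ⟨a, ha⟩ : ∃ a, χ a i ≠ χ a j := by
        by_contra! h
        exact hji (hχ i j h).symm
      -- The operator `T a - χ a j` kills the `j`-th term and multiplies the `i`-th by a nonzero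
      -- number, so the induction applies to the smaller set.
      have h1 : ∑ x ∈ s.erase j, (c x * (χ a x - χ a j)) • v x ∈ W := by
        have h2 := W.sub_mem (hW a _ hs) (W.smul_mem (χ a j) hs)
        rw [map_sum, Finset.smul_sum, ← Finset.sum_sub_distrib] at h2
        rw [← Finset.add_sum_erase s _ hj] at h2
        have h3 : ∀ x, T a (c x • v x) - χ a j • c x • v x = (c x * (χ a x - χ a j)) • v x := by
          intro x
          rw [map_smul, hT, smul_smul, smul_smul, ← sub_smul]
          congr 1
          ring
        simpa only [h3, sub_self, mul_zero, zero_smul, zero_add] using h2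
      have h2 := ih _ (Finset.erase_ssubset hj) _ h1 i (Finset.mem_erase.2 ⟨hji.symm, hi⟩)
      rw [mul_comm, mul_smul] at h2
      exact (W.smul_mem_iff (sub_ne_zero.2 ha)).1 h2
    · push Not at h
      have h1 : s = {i} := Finset.eq_singleton_iff_unique_mem.2 ⟨hi, h⟩
      rw [h1, Finset.sum_singleton] at hs
      exact hs

/-- Operators that separate the basis vectors. -/
def sepOp : Fin 4 → Sh →ₗ[ℂ] Sh :=
  ![LieModule.toEnd ℂ Gl2HC Sh (gUnit 0 0 0 0), LieModule.toEnd ℂ Gl2HC Sh (gUnit 0 0 1 1),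
    LieModule.toEnd ℂ Gl2HC Sh (gUnit 1 1 0 0),
    LieModule.toEnd ℂ Gl2HC Sh (gUnit 0 0 1 0) * LieModule.toEnd ℂ Gl2HC Sh (gUnit 0 0 0 1)]

/-- The eigenvalues of the operators `sepOp`. -/
def sepVal (a : Fin 4) (i : KIdx) : ℂ :=
  ![-(i.q + i.k + 2 : ℂ), -(i.p + i.r - i.q + i.k + 2 : ℂ), (i.p + i.k + 2 : ℂ),
    (i.q * (i.p + i.r + 1 - i.q) : ℂ)] a

theorem sepOp_basisVec (a : Fin 4) (i : KIdx) :
    sepOp a (basisVec i) = sepVal a i • basisVec i := by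
  obtain ⟨k, p, r, q, hq⟩ := i
  fin_cases a
  · exact lie_rowDiag_zero k p r q
  · exact lie_rowDiag_one k p r q
  · exact lie_colDiag_zero k p r q
  · change ⁅gUnit 0 0 1 0, ⁅gUnit 0 0 0 1, kVec k p r q⁆⁆ =
      (q * (p + r + 1 - q) : ℂ) • kVec k p r q
    rcases q with _ | q
    · rw [lie_rowLower_zero, lie_zero]
      simp
    · rw [lie_rowLower_succ, lie_smul, lie_rowRaise, smul_smul]
      congr 1
      push_cast
      ring

/-- The three diagonal weights determine the index up to `d = k' - k`, with `q' = q - d` and `L' = L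
- 2d`. The fourth, Casimir-like eigenvalue forces `d = 0` or `d = L + 1`, and the latter would make
`L'` negative. -/
theorem sepVal_injective (i j : KIdx) (h : ∀ a, sepVal a i = sepVal a j) : i = j := by
  obtain ⟨k, p, r, q, hq⟩ := i
  obtain ⟨k', p', r', q', hq'⟩ := j
  have h0 : -(q + k + 2 : ℂ) = -(q' + k' + 2) := h 0
  have h1 : -(p + r - q + k + 2 : ℂ) = -(p' + r' - q' + k' + 2) := h 1
  have h2 : (p + k + 2 : ℂ) = p' + k' + 2 := h 2
  have h3 : (q * (p + r + 1 - q) : ℂ) = q' * (p' + r' + 1 - q') := h 3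
  have g0 : -(q + k + 2 : ℤ) = -(q' + k' + 2) := by exact_mod_cast h0
  have g1 : -(p + r - q + k + 2 : ℤ) = -(p' + r' - q' + k' + 2) := by exact_mod_cast h1
  have g2 : (p + k + 2 : ℤ) = p' + k' + 2 := by exact_mod_cast h2
  have g3 : (q * (p + r + 1 - q) : ℤ) = q' * (p' + r' + 1 - q') := by exact_mod_cast h3
  have e1 : (q' : ℤ) = q + k - k' := by omega
  have e2 : (p' : ℤ) + r' = p + r + 2 * k - 2 * k' := by omega
  have e3 : (k' - k) * (k' - k - (p + r + 1)) = 0 := by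
    rw [e1, e2] at g3
    linear_combination -g3
  have hk : k' = k := by
    rcases mul_eq_zero.1 e3 with h | h <;> omega
  subst hk
  ext
  · rfl
  · change p = p'; omega
  · change r = r'; omega
  · change q = q'; omega

theorem linearIndependent_basisVec : LinearIndependent ℂ basisVec := by
  rw [linearIndependent_iff']
  intro s c hs i hi
  have h := mem_of_sum_mem_of_eigen (W := ⊥) sepOp (by simp) basisVec sepVal
    sepOp_basisVec sepVal_injective s c (by simp [hs]) i hi
  exact (smul_eq_zero.1 ((Submodule.mem_bot ℂ).1 h)).resolve_right (basisVec_ne_zero i)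

theorem sepOp_mem (W : LieSubmodule ℂ Gl2HC Sh) (a : Fin 4) (f : Sh) (hf : f ∈ W.toSubmodule) :
    sepOp a f ∈ W.toSubmodule := by
  fin_cases a
  · exact W.lie_mem hf
  · exact W.lie_mem hf
  · exact W.lie_mem hf
  · exact W.lie_mem (W.lie_mem hf)

theorem smul_basisVec_mem (W : LieSubmodule ℂ Gl2HC Sh) (s : Finset KIdx) (c : KIdx → ℂ)
    (h : ∑ i ∈ s, c i • basisVec i ∈ W) (i : KIdx) (hi : i ∈ s) : c i • basisVec i ∈ W :=
  mem_of_sum_mem_of_eigen sepOp (sepOp_mem W) basisVec sepVal sepOp_basisVec sepVal_injective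
    s c h i hi

/-- An invariant subspace contains the components of its elements. -/
theorem mem_of_add_mem (W : LieSubmodule ℂ Gl2HC Sh) {i j : KIdx} (hij : i ≠ j) {c d : ℂ}
    (h : c • basisVec i + d • basisVec j ∈ W) :
    (c ≠ 0 → basisVec i ∈ W) ∧ (d ≠ 0 → basisVec j ∈ W) := by
  classical
  have h1 : ∑ x ∈ {i, j}, (if x = i then c else d) • basisVec x ∈ W := by
    rw [Finset.sum_pair hij]
    simpa [hij.symm] using h
  have hi := smul_basisVec_mem W _ _ h1 i (by simp)
  have hj := smul_basisVec_mem W _ _ h1 j (by simp)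
  rw [if_pos rfl] at hi
  rw [if_neg hij.symm] at hj
  exact ⟨fun hc => (W.toSubmodule.smul_mem_iff hc).1 hi,
    fun hd => (W.toSubmodule.smul_mem_iff hd).1 hj⟩

/-! ### The spans of K-types -/

theorem spanK_eq (P : ℤ → ℤ → Prop) :
    spanK P = Submodule.span ℂ (basisVec '' {i | P i.k (i.p + i.r : ℕ)}) := by
  rw [spanK]
  congr 1
  ext f
  constructor
  · rintro ⟨k, L, p, q, hP, rfl⟩
    have hp := p.is_lt
    have hq := q.is_lt
    have hL : (p : ℕ) + (L - p) = L := by omega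
    refine ⟨⟨k, p, L - p, q, by omega⟩, ?_, (kType_eq k L p q).symm⟩
    simpa only [Set.mem_ofPred_eq, hL] using hP
  · rintro ⟨⟨k, p, r, q, hq⟩, hP, rfl⟩
    refine ⟨k, p + r, ⟨p, by omega⟩, ⟨q, by omega⟩, hP, ?_⟩
    rw [kType_eq]
    simp [basisVec]

theorem kVec_mem_spanK {P : ℤ → ℤ → Prop} {k : ℤ} {p r : ℕ} (q : ℕ) (h : P k (p + r : ℕ)) :
    kVec k p r q ∈ spanK P := by
  rw [spanK_eq]
  exact kVec_mem_of_basisVec_mem fun hq => Submodule.subset_span ⟨_, h, rfl⟩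

theorem basisVec_mem_spanK {P : ℤ → ℤ → Prop} {i : KIdx} :
    basisVec i ∈ spanK P ↔ P i.k (i.p + i.r : ℕ) := by
  refine ⟨fun h => ?_, fun h => kVec_mem_spanK _ h⟩
  rw [spanK_eq] at h
  by_contra hi
  exact linearIndependent_basisVec.notMem_span_image (s := {i | P i.k (i.p + i.r : ℕ)}) hi h

/-- The set of K-types contained in a subspace. -/
def kSupp (W : LieSubmodule ℂ Gl2HC Sh) (k l : ℤ) : Prop := kVec k 0 l.toNat 0 ∈ W

/-- Within a K-type the ladder operators have nonzero coefficients in both directions, so one vector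
decides membership of all; `kVec_mem_iff_p_zero` does the same for the column index. -/
theorem kVec_mem_iff_q_zero (W : LieSubmodule ℂ Gl2HC Sh) {k : ℤ} {p r q : ℕ}
    (hq : q ≤ p + r) : kVec k p r q ∈ W ↔ kVec k p r 0 ∈ W := by
  induction q with
  | zero => rfl
  | succ q ih =>
    rw [← ih (by omega)]
    constructor
    · intro h
      have h1 := W.lie_mem (x := gUnit 0 0 0 1) h
      rw [lie_rowLower_succ] at h1
      refine (W.toSubmodule.smul_mem_iff ?_).1 h1
      rw [neg_ne_zero, sub_ne_zero]
      exact_mod_cast (show p + r ≠ q by omega)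
    · intro h
      have h1 := W.lie_mem (x := gUnit 0 0 1 0) h
      rw [lie_rowRaise] at h1
      refine (W.toSubmodule.smul_mem_iff ?_).1 h1
      rw [neg_ne_zero]
      exact_mod_cast q.succ_ne_zero

theorem kVec_mem_iff_p_zero (W : LieSubmodule ℂ Gl2HC Sh) {k : ℤ} {p r q : ℕ} :
    kVec k p r q ∈ W ↔ kVec k 0 (p + r) q ∈ W := by
  induction p generalizing r with
  | zero => rw [zero_add]
  | succ p ih =>
    rw [show p + 1 + r = p + (r + 1) by omega, ← ih]
    constructor
    · intro h
      have h1 := W.lie_mem (x := gUnit 1 1 1 0) h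
      rw [lie_colLower, Nat.add_sub_cancel] at h1
      exact (W.toSubmodule.smul_mem_iff (Nat.cast_ne_zero.2 p.succ_ne_zero)).1 h1
    · intro h
      have h1 := W.lie_mem (x := gUnit 1 1 0 1) h
      rw [lie_colRaise, Nat.add_sub_cancel] at h1
      exact (W.toSubmodule.smul_mem_iff (Nat.cast_ne_zero.2 r.succ_ne_zero)).1 h1

theorem basisVec_mem_iff (W : LieSubmodule ℂ Gl2HC Sh) (i : KIdx) :
    basisVec i ∈ W ↔ kSupp W i.k (i.p + i.r : ℕ) := by
  rw [basisVec, kVec_mem_iff_q_zero W i.hq, kVec_mem_iff_p_zero, kSupp, Int.toNat_natCast]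

/-- An invariant subspace is spanned by the K-types it contains. -/
theorem toSubmodule_eq_spanK (W : LieSubmodule ℂ Gl2HC Sh) : W.toSubmodule = spanK (kSupp W) := by
  refine le_antisymm (fun f hf => ?_) ?_
  · have hf' : f ∈ Submodule.span ℂ (Set.range basisVec) := by
      rw [span_basisVec]; trivial
    obtain ⟨c, rfl⟩ := (Finsupp.mem_span_range_iff_exists_finsupp).1 hf'
    refine Submodule.sum_mem _ fun i hi => ?_
    -- Eigenvector separation puts each basis component of `f` into `W`.
    have h := smul_basisVec_mem W _ _ hf i hi
    refine Submodule.smul_mem _ _ (basisVec_mem_spanK.2 ((basisVec_mem_iff W i).1 ?_))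
    exact (W.toSubmodule.smul_mem_iff (Finsupp.mem_support_iff.1 hi)).1 h
  · rw [spanK_eq, Submodule.span_le]
    rintro _ ⟨i, hi, rfl⟩
    exact (basisVec_mem_iff W i).2 hi

/-- Embeds the lattice of invariant subspaces into sets of pairs `(k, L)`. Only natural `L` matters.
-/
theorem le_iff_kSupp {W W' : LieSubmodule ℂ Gl2HC Sh} :
    W ≤ W' ↔ ∀ (k : ℤ) (L : ℕ), kSupp W k L → kSupp W' k L := by
  refine ⟨fun h k L hk => h hk, fun h => ?_⟩
  rw [← LieSubmodule.toSubmodule_le_toSubmodule, toSubmodule_eq_spanK W, spanK_eq,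
    Submodule.span_le]
  rintro _ ⟨i, hi, rfl⟩
  exact (basisVec_mem_iff W' i).2 (h _ _ hi)

theorem kSupp_of_toSubmodule_eq {W : LieSubmodule ℂ Gl2HC Sh} {P : ℤ → ℤ → Prop}
    (h : W.toSubmodule = spanK P) (k : ℤ) (L : ℕ) : kSupp W k L ↔ P k L := by
  have h1 := basisVec_mem_spanK (P := P) (i := ⟨k, 0, L, 0, by omega⟩)
  rw [← h] at h1
  rw [kSupp, Int.toNat_natCast]
  simp only [zero_add] at h1
  exact h1

theorem kSupp_sup (U V : LieSubmodule ℂ Gl2HC Sh) (k : ℤ) (L : ℕ) :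
    kSupp (U ⊔ V) k L ↔ kSupp U k L ∨ kSupp V k L := by
  refine kSupp_of_toSubmodule_eq (P := fun k L => kSupp U k L ∨ kSupp V k L) ?_ k L
  rw [LieSubmodule.sup_toSubmodule, toSubmodule_eq_spanK U, toSubmodule_eq_spanK V, spanK_eq,
    spanK_eq, spanK_eq, ← Submodule.span_union, ← Set.image_union]
  rfl

theorem kSupp_inf (U V : LieSubmodule ℂ Gl2HC Sh) (k : ℤ) (L : ℕ) :
    kSupp (U ⊓ V) k L ↔ kSupp U k L ∧ kSupp V k L :=
  LieSubmodule.mem_inf _ _ _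

theorem kSupp_top (k : ℤ) (L : ℕ) : kSupp ⊤ k L := LieSubmodule.mem_top _

theorem not_kSupp_bot (k : ℤ) (L : ℕ) : ¬kSupp ⊥ k L := fun h =>
  kVec_zero_ne_zero _ _ _ ((LieSubmodule.mem_bot _).1 h)

/-! ### Transitions between K-types -/

/-- The sets of K-types that are stable under the transitions with nonzero coefficients. -/
structure IsKClosed (P : ℤ → ℤ → Prop) : Prop where
  lower_snd : ∀ (k : ℤ) (L : ℕ), k ≠ 0 → P k L → P (k - 1) (L + 1 : ℕ)
  lower_fst : ∀ (k : ℤ) (L : ℕ), k + L + 2 ≠ 0 → P k (L + 1 : ℕ) → P k L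
  raise_fst : ∀ (k : ℤ) (L : ℕ), k + L + 4 ≠ 0 → P k L → P k (L + 1 : ℕ)
  raise_snd : ∀ (k : ℤ) (L : ℕ), k + 3 ≠ 0 → P k (L + 1 : ℕ) → P (k + 1) L

/-- The two terms of `lie_lowering` lie in different K-types, so an invariant subspace contains each
one whose coefficient is nonzero. -/
theorem kSupp_lower (W : LieSubmodule ℂ Gl2HC Sh) (k : ℤ) (L : ℕ) (h : kSupp W k L) :
    (k ≠ 0 → kSupp W (k - 1) (L + 1 : ℕ)) ∧
      (L * (k + L + 1) ≠ 0 → kSupp W k (L - 1 : ℕ)) := by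
  have h1 := W.smul_mem (((0 : ℕ) : ℂ) + L + 1) (W.lie_mem (x := gUnit 0 1 1 1) h)
  rw [Int.toNat_natCast, lie_lowering] at h1
  -- For `L = 0` the truncated index `L - 1` is meaningless, but its coefficient contains the factor
  -- `L` and vanishes.
  have h2 := mem_of_add_mem W (i := ⟨k - 1, 1, L, 1, by omega⟩) (j := ⟨k, 0, L - 1, 0, by omega⟩)
    (by simp [KIdx.mk.injEq]) h1
  rw [basisVec_mem_iff, basisVec_mem_iff] at h2
  simp only [zero_add] at h2
  rw [add_comm 1 L] at h2
  refine ⟨fun hk => h2.1 ?_, fun hk => h2.2 ?_⟩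
  · simpa using hk
  · rw [neg_ne_zero]
    push_cast
    rw [add_zero]
    exact_mod_cast hk

theorem kSupp_raise (W : LieSubmodule ℂ Gl2HC Sh) (k : ℤ) (L : ℕ) (h : kSupp W k L) :
    (k + L + 4 ≠ 0 → kSupp W k (L + 1 : ℕ)) ∧
      ((k + 3) * L ≠ 0 → kSupp W (k + 1) (L - 1 : ℕ)) := by
  have h1 := W.smul_mem (((0 : ℕ) : ℂ) + L + 1) (W.lie_mem (x := gUnit 1 0 0 0) h)
  rw [Int.toNat_natCast, lie_raising] at h1
  have h2 := mem_of_add_mem W (i := ⟨k, 1, L, 1, by omega⟩) (j := ⟨k + 1, 0, L - 1, 0, by omega⟩)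
    (by simp [KIdx.mk.injEq]) h1
  rw [basisVec_mem_iff, basisVec_mem_iff] at h2
  simp only [zero_add] at h2
  rw [add_comm 1 L] at h2
  refine ⟨fun hk => h2.1 ?_, fun hk => h2.2 ?_⟩
  · push_cast
    rw [add_zero, zero_add, mul_one]
    exact_mod_cast hk
  · exact_mod_cast hk

theorem isKClosed_kSupp (W : LieSubmodule ℂ Gl2HC Sh) : IsKClosed (kSupp W) where
  lower_snd k L hk h := (kSupp_lower W k L h).1 hk
  lower_fst k L hk h := by
    refine (kSupp_lower W k (L + 1) h).2 (mul_ne_zero ?_ ?_) <;> push_cast <;> omega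
  raise_fst k L hk h := (kSupp_raise W k L h).1 hk
  raise_snd k L hk h := by
    refine (kSupp_raise W k (L + 1) h).2 (mul_ne_zero ?_ ?_) <;> push_cast <;> omega

/-- The transitions allowed for each of the two coordinates `k + L + 1` and `k` of a K-type. -/
def Passable (x x' : ℤ) : Prop := (-3 < x ∨ x' ≤ -3) ∧ (x < 0 ∨ 0 ≤ x')

/-- The two coordinates move independently except for the constraint `y < x`. Choosing which one
moves first keeps the path in the region: `x` first if it increases, `y` first if `x` decreases. -/
theorem reach_of_steps {Q : ℤ → ℤ → Prop}
    (hxu : ∀ x y, y < x → x ≠ -3 → Q x y → Q (x + 1) y)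
    (hxd : ∀ x y, y < x - 1 → x ≠ 0 → Q x y → Q (x - 1) y)
    (hyu : ∀ x y, y + 1 < x → y ≠ -3 → Q x y → Q x (y + 1))
    (hyd : ∀ x y, y < x → y ≠ 0 → Q x y → Q x (y - 1))
    {x y x' y' : ℤ} (hxy : y < x) (hxy' : y' < x') (hx : Passable x x') (hy : Passable y y')
    (h : Q x y) : Q x' y' := by
  have xUp : ∀ (x y : ℤ), y < x → Q x y → ∀ x', x ≤ x' → (-3 < x ∨ x' ≤ -3) → Q x' y := by
    intro x y hxy h x' hx'
    induction x', hx' using Int.leInduction with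
    | base => exact fun _ => h
    | succ n hn ih => exact fun hc => hxu n y (by omega) (by omega) (ih (by omega))
  have xDown : ∀ (x y : ℤ), Q x y → ∀ x', x' ≤ x → y < x' → (x < 0 ∨ 0 ≤ x') → Q x' y := by
    intro x y h x' hx'
    induction x', hx' using Int.leInductionDown with
    | base => exact fun _ _ => h
    | pred n hn ih => exact fun hc _ => hxd n y (by omega) (by omega) (ih (by omega) (by omega))
  have yUp : ∀ (x y : ℤ), Q x y → ∀ y', y ≤ y' → y' < x → (-3 < y ∨ y' ≤ -3) → Q x y' := by
    intro x y h y' hy'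
    induction y', hy' using Int.leInduction with
    | base => exact fun _ _ => h
    | succ n hn ih => exact fun hc _ => hyu x n (by omega) (by omega) (ih (by omega) (by omega))
  have yDown : ∀ (x y : ℤ), y < x → Q x y → ∀ y', y' ≤ y → (y < 0 ∨ 0 ≤ y') → Q x y' := by
    intro x y hxy h y' hy'
    induction y', hy' using Int.leInductionDown with
    | base => exact fun _ => h
    | pred n hn ih => exact fun hc => hyd x n (by omega) (by omega) (ih (by omega))
  have yMove : ∀ x, y < x → y' < x → Q x y → Q x y' := by
    intro x h1 h2 h3
    rcases le_total y y' with h4 | h4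
    · exact yUp x y h3 y' h4 h2 hy.1
    · exact yDown x y h1 h3 y' h4 hy.2
  rcases le_total x x' with h1 | h1
  · exact yMove x' (by omega) hxy' (xUp x y hxy h x' h1 hx.1)
  · exact xDown x y' (yMove x hxy (by omega) h) x' h1 hxy' hx.2

/-- In the coordinates `x = k + L + 1`, `y = k` each closure condition moves one coordinate by one;
`L` is recovered as `x - y - 1`. -/
theorem IsKClosed.reach {P : ℤ → ℤ → Prop} (hP : IsKClosed P) {k k' : ℤ} {L L' : ℕ}
    (hx : Passable (k + L + 1) (k' + L' + 1)) (hy : Passable k k') (h : P k L) : P k' L' := by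
  have key := reach_of_steps (Q := fun x y => P y (x - y - 1 : ℤ)) (x := k + L + 1) (y := k)
    (x' := k' + L' + 1) (y' := k') ?_ ?_ ?_ ?_ (by omega) (by omega) hx hy ?_
  · convert key using 1
    ring
  · intro x y hxy hx h
    obtain ⟨n, hn⟩ := Int.eq_ofNat_of_zero_le (show 0 ≤ x - y - 1 by omega)
    rw [hn] at h
    have := hP.raise_fst y n (by omega) h
    convert this using 1
    omega
  · intro x y hxy hx h
    obtain ⟨n, hn⟩ := Int.eq_ofNat_of_zero_le (show 0 ≤ x - y - 2 by omega)
    rw [show x - y - 1 = (n + 1 : ℕ) by omega] at h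
    have := hP.lower_fst y n (by omega) h
    convert this using 1
    omega
  · intro x y hxy hx h
    obtain ⟨n, hn⟩ := Int.eq_ofNat_of_zero_le (show 0 ≤ x - y - 2 by omega)
    rw [show x - y - 1 = (n + 1 : ℕ) by omega] at h
    have := hP.raise_snd y n (by omega) h
    convert this using 1
    omega
  · intro x y hxy hx h
    obtain ⟨n, hn⟩ := Int.eq_ofNat_of_zero_le (show 0 ≤ x - y - 1 by omega)
    rw [hn] at h
    have := hP.lower_snd y n (by omega) h
    convert this using 1
    omega
  · convert h using 1
    ring

/-! ### Invariance of the spans of K-types -/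

theorem gl_decomp (X : Gl2HC) :
    X = ∑ a, ∑ b, ∑ i, ∑ j, X a b i j • gUnit a b i j := by
  ext a b i j
  simp only [Matrix.sum_apply, Fin.sum_univ_two]
  have h2 : ∀ i : Fin 2, i = 0 ∨ i = 1 := by decide
  rcases h2 a with rfl | rfl <;> rcases h2 b with rfl | rfl <;> rcases h2 i with rfl | rfl <;>
    rcases h2 j with rfl | rfl <;> simp [gUnit_entry]

/-- The hypothesis says exactly that the product in the opposite order vanishes. -/
theorem lie_gUnit {a b c i j j' : Fin 2} (h : ¬(a = c ∧ i = j')) :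
    ⁅gUnit a b i j, gUnit b c j j'⁆ = gUnit a c i j' := by
  rw [LieRing.of_associative_ring_bracket, gUnit, gUnit, gUnit, Matrix.single_mul_single_same,
    Matrix.single_mul_single_same, mul_one]
  rw [sub_eq_self]
  by_cases hc : c = a
  · subst hc
    rw [Matrix.single_mul_single_same,
      Matrix.single_mul_single_of_ne _ _ _ _ (fun hj => h ⟨rfl, hj.symm⟩)]
    simp
  · rw [Matrix.single_mul_single_of_ne _ _ _ _ hc]

/-- One unit from each off-diagonal block generates that block under brackets with the
block-diagonal units, so the two formulas `lie_lowering` and `lie_raising` suffice. -/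
theorem mem_of_gUnit_mem (G : LieSubalgebra ℂ Gl2HC)
    (hr0 : gUnit 0 0 0 0 ∈ G) (hr1 : gUnit 0 0 1 1 ∈ G) (hr10 : gUnit 0 0 1 0 ∈ G)
    (hr01 : gUnit 0 0 0 1 ∈ G) (hc0 : gUnit 1 1 0 0 ∈ G) (hc1 : gUnit 1 1 1 1 ∈ G)
    (hc01 : gUnit 1 1 0 1 ∈ G) (hc10 : gUnit 1 1 1 0 ∈ G) (hB11 : gUnit 0 1 1 1 ∈ G)
    (hC00 : gUnit 1 0 0 0 ∈ G) (X : Gl2HC) : X ∈ G := by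
  have lie_mem : ∀ {a b c i j j' : Fin 2}, ¬(a = c ∧ i = j') → gUnit a b i j ∈ G →
      gUnit b c j j' ∈ G → gUnit a c i j' ∈ G := by
    intro a b c i j j' h h1 h2
    rw [← lie_gUnit (b := b) (j := j) h]
    exact G.lie_mem h1 h2
  have hB01 : gUnit 0 1 0 1 ∈ G := lie_mem (by decide) hr01 hB11
  have hB10 : gUnit 0 1 1 0 ∈ G := lie_mem (by decide) hB11 hc10
  have hB00 : gUnit 0 1 0 0 ∈ G := lie_mem (by decide) hr01 hB10
  have hC10 : gUnit 1 0 1 0 ∈ G := lie_mem (by decide) hc10 hC00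
  have hC01 : gUnit 1 0 0 1 ∈ G := lie_mem (by decide) hC00 hr01
  have hC11 : gUnit 1 0 1 1 ∈ G := lie_mem (by decide) hc10 hC01
  have h2 : ∀ i : Fin 2, i = 0 ∨ i = 1 := by decide
  have hU : ∀ a b i j, gUnit a b i j ∈ G := by
    intro a b i j
    rcases h2 a with rfl | rfl <;> rcases h2 b with rfl | rfl <;> rcases h2 i with rfl | rfl <;>
      rcases h2 j with rfl | rfl <;>
      simp only [hr0, hr1, hr01, hr10, hc0, hc1, hc01, hc10, hB00, hB01, hB10, hB11, hC00, hC01,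
        hC10, hC11]
  rw [gl_decomp X]
  exact Submodule.sum_mem G.toSubmodule fun a _ => Submodule.sum_mem _ fun b _ =>
    Submodule.sum_mem _ fun i _ => Submodule.sum_mem _ fun j _ =>
      Submodule.smul_mem _ _ (hU a b i j)

theorem lie_mem_spanK {P : ℤ → ℤ → Prop} (hP : IsKClosed P) {f : Sh} (hf : f ∈ spanK P)
    (X : Gl2HC) : ⁅X, f⁆ ∈ spanK P := by
  -- The stabilizer of the span is a Lie subalgebra, so only generators have to be tested.
  let G : LieSubalgebra ℂ Gl2HC :=
    { carrier := {X | ∀ f ∈ spanK P, ⁅X, f⁆ ∈ spanK P}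
      add_mem' := fun {X Y} hX hY f hf => by
        rw [add_lie]; exact add_mem (hX f hf) (hY f hf)
      zero_mem' := fun f _ => by rw [zero_lie]; exact zero_mem _
      smul_mem' := fun c X hX f hf => by
        rw [smul_lie]; exact Submodule.smul_mem _ _ (hX f hf)
      lie_mem' := fun {X Y} hX hY f hf => by
        rw [lie_lie]; exact sub_mem (hX _ (hY f hf)) (hY _ (hX f hf)) }
  have hG : ∀ X : Gl2HC, (∀ (k : ℤ) (p r q : ℕ), P k (p + r : ℕ) →
      ⁅X, kVec k p r q⁆ ∈ spanK P) → X ∈ G := by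
    intro X hX f hf
    rw [spanK_eq] at hf
    induction hf using Submodule.span_induction with
    | mem x hx =>
      obtain ⟨i, hi, rfl⟩ := hx
      exact hX _ _ _ _ hi
    | zero => rw [lie_zero]; exact zero_mem _
    | add x y _ _ hx hy => rw [lie_add]; exact add_mem hx hy
    | smul c x _ hx => rw [lie_smul]; exact Submodule.smul_mem _ _ hx
  have hr0 : gUnit 0 0 0 0 ∈ G := hG _ fun k p r q h => by
    rw [lie_rowDiag_zero]; exact Submodule.smul_mem _ _ (kVec_mem_spanK q h)
  have hr1 : gUnit 0 0 1 1 ∈ G := hG _ fun k p r q h => by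
    rw [lie_rowDiag_one]; exact Submodule.smul_mem _ _ (kVec_mem_spanK q h)
  have hr10 : gUnit 0 0 1 0 ∈ G := hG _ fun k p r q h => by
    rw [lie_rowRaise]; exact Submodule.smul_mem _ _ (kVec_mem_spanK _ h)
  have hr01 : gUnit 0 0 0 1 ∈ G := hG _ fun k p r q h => by
    rcases q with _ | q
    · rw [lie_rowLower_zero]; exact zero_mem _
    · rw [lie_rowLower_succ]; exact Submodule.smul_mem _ _ (kVec_mem_spanK _ h)
  have hc0 : gUnit 1 1 0 0 ∈ G := hG _ fun k p r q h => by
    rw [lie_colDiag_zero]; exact Submodule.smul_mem _ _ (kVec_mem_spanK q h)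
  have hc1 : gUnit 1 1 1 1 ∈ G := hG _ fun k p r q h => by
    rw [lie_colDiag_one]; exact Submodule.smul_mem _ _ (kVec_mem_spanK q h)
  have hc01 : gUnit 1 1 0 1 ∈ G := hG _ fun k p r q h => by
    rw [lie_colRaise]
    rcases r with _ | r
    · rw [Nat.cast_zero, zero_smul]; exact zero_mem _
    · refine Submodule.smul_mem _ _ (kVec_mem_spanK _ ?_)
      rwa [Nat.add_sub_cancel, show p + 1 + r = p + (r + 1) by omega]
  have hc10 : gUnit 1 1 1 0 ∈ G := hG _ fun k p r q h => by
    rw [lie_colLower]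
    rcases p with _ | p
    · rw [Nat.cast_zero, zero_smul]; exact zero_mem _
    · refine Submodule.smul_mem _ _ (kVec_mem_spanK _ ?_)
      rwa [Nat.add_sub_cancel, show p + (r + 1) = p + 1 + r by omega]
  -- A target K-type is required only if its coefficient is nonzero, matching the exceptions in
  -- `IsKClosed`.
  have smul_mem_of : ∀ (c : ℂ) (k : ℤ) (p r q : ℕ), (c ≠ 0 → P k (p + r : ℕ)) →
      c • kVec k p r q ∈ spanK P := by
    intro c k p r q h
    by_cases hc : c = 0
    · rw [hc, zero_smul]; exact zero_mem _
    · exact Submodule.smul_mem _ _ (kVec_mem_spanK _ (h hc))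
  have hB11 : gUnit 0 1 1 1 ∈ G := hG _ fun k p r q h => by
    rw [← Submodule.smul_mem_iff _ (add_add_one_ne_zero p r), lie_lowering]
    refine add_mem (smul_mem_of _ _ _ _ _ fun hc => ?_) (smul_mem_of _ _ _ _ _ fun hc => ?_)
    · rw [show p + 1 + r = p + r + 1 by omega]
      refine hP.lower_snd k _ ?_ h
      rintro rfl
      simp at hc
    · rcases r with _ | r
      · simp at hc
      · refine hP.lower_fst k _ ?_ h
        intro h0
        apply hc
        have h1 : (k + p + (r + 1) + 1 : ℂ) = 0 := by
          have : (k + p + (r + 1) + 1 : ℤ) = 0 := by push_cast at h0; omega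
          exact_mod_cast this
        push_cast
        rw [h1]
        simp
  have hC00 : gUnit 1 0 0 0 ∈ G := hG _ fun k p r q h => by
    rw [← Submodule.smul_mem_iff _ (add_add_one_ne_zero p r), lie_raising]
    refine add_mem (smul_mem_of _ _ _ _ _ fun hc => ?_) (smul_mem_of _ _ _ _ _ fun hc => ?_)
    · rw [show p + 1 + r = p + r + 1 by omega]
      refine hP.raise_fst k _ ?_ h
      intro h0
      apply hc
      have h1 : (k + p + r + 4 : ℂ) = 0 := by
        have : (k + p + r + 4 : ℤ) = 0 := by push_cast at h0; omega
        exact_mod_cast this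
      rw [h1, zero_mul]
    · rcases r with _ | r
      · simp at hc
      · refine hP.raise_snd k _ ?_ h
        intro h0
        apply hc
        have h1 : (k + 3 : ℂ) = 0 := by exact_mod_cast h0
        rw [h1, zero_mul]
  exact mem_of_gUnit_mem G hr0 hr1 hr10 hr01 hc0 hc1 hc01 hc10 hB11 hC00 X f hf

/-- The invariant subspace spanned by a closed set of K-types. -/
def closedSpan (P : ℤ → ℤ → Prop) (hP : IsKClosed P) : LieSubmodule ℂ Gl2HC Sh where
  __ := spanK P
  lie_mem {X _} hf := lie_mem_spanK hP hf X

theorem kSupp_closedSpan (P : ℤ → ℤ → Prop) (hP : IsKClosed P) (k : ℤ) (L : ℕ) :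
    kSupp (closedSpan P hP) k L ↔ P k L := kSupp_of_toSubmodule_eq rfl k L

/-! ### Quotients of Lie modules -/

section Quotients

variable {R L M N : Type*} [CommRing R] [LieRing L]
  [AddCommGroup M] [Module R M] [LieRingModule L M]
  [AddCommGroup N] [Module R N] [LieRingModule L N]

/-- The invariant subspaces of an invariant subspace. -/
def subOrderIso (V : LieSubmodule R L M) : LieSubmodule R L V ≃o Set.Iic V where
  toFun N := ⟨N.map V.incl, LieSubmodule.map_incl_le⟩
  invFun U := U.1.comap V.incl
  left_inv N := by
    ext x
    constructor
    · rintro ⟨y, hy, h⟩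
      rwa [← V.injective_incl h]
    · exact fun h => ⟨x, h, rfl⟩
  right_inv U := by
    refine Subtype.ext (LieSubmodule.ext _ _ fun x => ⟨?_, fun h => ⟨⟨x, U.2 h⟩, h, rfl⟩⟩)
    rintro ⟨y, hy, rfl⟩
    exact hy
  map_rel_iff' {N N'} := LieSubmodule.map_le_map_iff V.injective_incl

theorem isCoatom_comap_incl_iff {U V : LieSubmodule R L M} (h : U ≤ V) :
    IsCoatom (U.comap V.incl) ↔ U ⋖ V := by
  rw [← (subOrderIso V).isCoatom_iff, Set.Iic.isCoatom_iff]
  have h1 : ((subOrderIso V (U.comap V.incl) : Set.Iic V) : LieSubmodule R L M) = U :=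
    congrArg Subtype.val ((subOrderIso V).apply_symm_apply ⟨U, h⟩)
  rw [h1]

theorem isIrreducible_of_equiv (e : M ≃ₗ⁅R,L⁆ N) (h : LieModule.IsIrreducible R L M) :
    LieModule.IsIrreducible R L N :=
  (LieSubmodule.orderIsoMapComap e).isSimpleOrder_iff.1 h

variable [LieAlgebra R L] [LieModule R L M]

/-- The first isomorphism theorem for Lie modules. -/
theorem nonempty_quotEquiv (f : M →ₗ⁅R,L⁆ N) (hf : Function.Surjective f)
    (K : LieSubmodule R L M) (hK : ∀ x, f x = 0 ↔ x ∈ K) : Nonempty ((M ⧸ K) ≃ₗ⁅R,L⁆ N) := by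
  have hker : K.toSubmodule = LinearMap.ker (f : M →ₗ[R] N) := by
    ext x
    exact (hK x).symm
  let g : (M ⧸ K.toSubmodule) →ₗ[R] N := K.toSubmodule.liftQ (f : M →ₗ[R] N) hker.le
  have hg : Function.Bijective g := by
    constructor
    · rw [← LinearMap.ker_eq_bot]
      exact Submodule.ker_liftQ_eq_bot' _ _ hker
    · intro y
      obtain ⟨x, rfl⟩ := hf y
      exact ⟨Submodule.Quotient.mk x, rfl⟩
  let e : (M ⧸ K.toSubmodule) ≃ₗ[R] N := LinearEquiv.ofBijective g hg
  refine ⟨LieModuleEquiv.mk ⟨e.toLinearMap, ?_⟩ e.symm e.left_inv e.right_inv⟩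
  intro x m
  induction m using Submodule.Quotient.induction_on with
  | H m => exact f.map_lie x m

/-- The invariant subspaces of a quotient. -/
def quotOrderIso (K : LieSubmodule R L M) : LieSubmodule R L (M ⧸ K) ≃o Set.Ici K where
  toFun N := ⟨N.comap (LieSubmodule.Quotient.mk' K), fun x hx => by
    rw [LieSubmodule.mem_comap, (LieSubmodule.Quotient.mk_eq_zero K).2 hx]
    exact N.zero_mem⟩
  invFun V := V.1.map (LieSubmodule.Quotient.mk' K)
  left_inv N := by
    ext x
    obtain ⟨y, rfl⟩ := LieSubmodule.Quotient.surjective_mk' K x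
    constructor
    · rintro ⟨z, hz, h⟩
      rw [← h]
      exact hz
    · exact fun h => ⟨y, h, rfl⟩
  right_inv V := by
    refine Subtype.ext (LieSubmodule.ext _ _ fun x => ⟨?_, fun h => ⟨x, h, rfl⟩⟩)
    rintro ⟨z, hz, h⟩
    have h1 : x - z ∈ K := by
      rw [← LieSubmodule.Quotient.mk_eq_zero, map_sub, sub_eq_zero]
      exact h.symm
    have h2 := V.1.add_mem (V.2 h1) hz
    rwa [sub_add_cancel] at h2
  map_rel_iff' {N N'} := by
    constructor
    · intro h x hx
      obtain ⟨y, rfl⟩ := LieSubmodule.Quotient.surjective_mk' K x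
      exact h hx
    · exact fun h x hx => h hx

theorem isIrreducible_quot_iff (K : LieSubmodule R L M) :
    LieModule.IsIrreducible R L (M ⧸ K) ↔ IsCoatom K :=
  (quotOrderIso K).isSimpleOrder_iff.trans Set.isSimpleOrder_Ici_iff_isCoatom

end Quotients

/-! ### Subquotients of `Sh` -/

section Subquotients

variable {U V W K : LieSubmodule ℂ Gl2HC Sh}

theorem isIrreducible_subquot_iff (h : U ≤ V) :
    LieModule.IsIrreducible ℂ Gl2HC (Subquot V U) ↔ U ⋖ V :=
  (isIrreducible_quot_iff _).trans (isCoatom_comap_incl_iff h)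

/-- The second isomorphism theorem. -/
theorem nonempty_subquotEquiv (hsup : W ⊔ U = V) (hinf : W ⊓ U = K) :
    Nonempty (Subquot V U ≃ₗ⁅ℂ, Gl2HC⁆ Subquot W K) := by
  have hWV : W ≤ V := hsup ▸ le_sup_left
  refine (nonempty_quotEquiv
    ((LieSubmodule.Quotient.mk' (U.comap V.incl)).comp (LieSubmodule.inclusion hWV)) ?_
    (K.comap W.incl) ?_).map fun e => e.symm
  · intro y
    obtain ⟨⟨x, hx⟩, rfl⟩ := LieSubmodule.Quotient.surjective_mk' _ y
    have hx' := hx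
    rw [← hsup, LieSubmodule.mem_sup] at hx'
    obtain ⟨w, hw, u, hu, rfl⟩ := hx'
    refine ⟨⟨w, hw⟩, ?_⟩
    rw [LieModuleHom.comp_apply, ← sub_eq_zero, ← map_sub, LieSubmodule.Quotient.mk_eq_zero,
      LieSubmodule.mem_comap]
    change w - (w + u) ∈ U
    rw [sub_add_cancel_left]
    exact neg_mem hu
  · rintro ⟨x, hx⟩
    rw [LieModuleHom.comp_apply, LieSubmodule.Quotient.mk_eq_zero, LieSubmodule.mem_comap,
      LieSubmodule.mem_comap, ← hinf]
    exact ⟨fun h => ⟨hx, h⟩, fun h => h.2⟩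

theorem nonempty_subquot_bot_equiv (V : LieSubmodule ℂ Gl2HC Sh) :
    Nonempty (Subquot V ⊥ ≃ₗ⁅ℂ, Gl2HC⁆ V) :=
  nonempty_quotEquiv LieModuleHom.id Function.surjective_id _ fun x => by
    rw [LieSubmodule.mem_comap, LieSubmodule.mem_bot, LieModuleHom.id_apply]
    exact Subtype.ext_iff

theorem nonempty_subquot_top_equiv (U : LieSubmodule ℂ Gl2HC Sh) :
    Nonempty (Subquot ⊤ U ≃ₗ⁅ℂ, Gl2HC⁆ Sh ⧸ U) :=
  nonempty_quotEquiv ((LieSubmodule.Quotient.mk' U).comp (⊤ : LieSubmodule ℂ Gl2HC Sh).incl)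
    (fun y => by
      obtain ⟨x, rfl⟩ := LieSubmodule.Quotient.surjective_mk' U y
      exact ⟨⟨x, LieSubmodule.mem_top x⟩, rfl⟩)
    _ fun x => LieSubmodule.Quotient.mk_eq_zero U

end Subquotients

/-! ### Invariant subspaces and their K-types -/

theorem eq_of_kSupp {W W' : LieSubmodule ℂ Gl2HC Sh}
    (h : ∀ (k : ℤ) (L : ℕ), kSupp W k L ↔ kSupp W' k L) : W = W' :=
  le_antisymm (le_iff_kSupp.2 fun k L => (h k L).1) (le_iff_kSupp.2 fun k L => (h k L).2)

theorem exists_kSupp_of_not_le {W W' : LieSubmodule ℂ Gl2HC Sh} (h : ¬W ≤ W') :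
    ∃ (k : ℤ) (L : ℕ), kSupp W k L ∧ ¬kSupp W' k L := by
  rw [le_iff_kSupp] at h
  push Not at h
  exact h

theorem lt_of_kSupp {W W' : LieSubmodule ℂ Gl2HC Sh}
    (h : ∀ (k : ℤ) (L : ℕ), kSupp W k L → kSupp W' k L) (k : ℤ) (L : ℕ) (h1 : kSupp W' k L)
    (h2 : ¬kSupp W k L) : W < W' :=
  lt_of_le_not_ge (le_iff_kSupp.2 h) fun h' => h2 (le_iff_kSupp.1 h' k L h1)

/-- `W` is generated by any of its K-types that is not contained in `R`. -/
structure IsLocalPair (W R : LieSubmodule ℂ Gl2HC Sh) : Prop where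
  le : R ≤ W
  not_le : ¬W ≤ R
  reach : ∀ (k : ℤ) (L : ℕ) (k' : ℤ) (L' : ℕ), kSupp W k L → ¬kSupp R k L → kSupp W k' L' →
    Passable (k + L + 1) (k' + L' + 1) ∧ Passable k k'

theorem IsLocalPair.le_of_kSupp {W R V : LieSubmodule ℂ Gl2HC Sh} (h : IsLocalPair W R) {k : ℤ}
    {L : ℕ} (hW : kSupp W k L) (hR : ¬kSupp R k L) (hV : kSupp V k L) : W ≤ V :=
  le_iff_kSupp.2 fun k' L' h' =>
    have h1 := h.reach k L k' L' hW hR h'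
    (isKClosed_kSupp V).reach h1.1 h1.2 hV

/-- A K-type of `N` outside `R` generates all of `W`; thus `R` is the largest proper invariant
subspace of `W`. -/
theorem IsLocalPair.le_or_le {W R : LieSubmodule ℂ Gl2HC Sh} (h : IsLocalPair W R)
    (N : LieSubmodule ℂ Gl2HC Sh) (hN : N ≤ W) : W ≤ N ∨ N ≤ R := by
  by_contra! hc
  obtain ⟨k, L, h1, h2⟩ := exists_kSupp_of_not_le hc.2
  exact hc.1 (h.le_of_kSupp (le_iff_kSupp.1 hN k L h1) h2 h1)

theorem IsLocalPair.covBy {W R : LieSubmodule ℂ Gl2HC Sh} (h : IsLocalPair W R) : R ⋖ W := by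
  refine ⟨lt_of_le_not_ge h.le h.not_le, fun N h1 h2 => ?_⟩
  rcases h.le_or_le N h2.le with h3 | h3
  · exact h2.not_ge h3
  · exact h1.not_ge h3

/-- A K-type in `V` but not in `U` identifies the simple quotient `V/U`: the subspace `W` it
generates lies in `V` but not in `U`, so `W + U = V` and `V/U` is `W/(W ∩ U)`. -/
theorem IsLocalPair.nonempty_equiv {W R U V : LieSubmodule ℂ Gl2HC Sh} (h : IsLocalPair W R)
    (hUV : U ⋖ V) {k : ℤ} {L : ℕ} (hW : kSupp W k L) (hR : ¬kSupp R k L) (hV : kSupp V k L)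
    (hU : ¬kSupp U k L) : Nonempty (Subquot V U ≃ₗ⁅ℂ, Gl2HC⁆ Subquot W R) := by
  have hWV : W ≤ V := h.le_of_kSupp hW hR hV
  have hWU : ¬W ≤ U := fun h' => hU (le_iff_kSupp.1 h' k L hW)
  have hsup : W ⊔ U = V := by
    rcases hUV.eq_or_eq (le_sup_right : U ≤ W ⊔ U) (sup_le hWV hUV.le) with h1 | h1
    · exact absurd (h1 ▸ le_sup_left) hWU
    · exact h1
  refine nonempty_subquotEquiv hsup ?_
  -- By modularity `W ⊓ U` is maximal in `W`; it lies in `R`, the largest proper invariant subspace,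
  -- hence equals it.
  have hcov : W ⊓ U ⋖ W := inf_covBy_of_covBy_sup_right (hsup.symm ▸ hUV)
  rcases h.le_or_le (W ⊓ U) inf_le_left with h1 | h1
  · exact absurd (h1.trans inf_le_right) hWU
  · rcases hcov.eq_or_eq h1 h.le with h2 | h2
    · exact h2.symm
    · exact absurd h2.ge h.not_le

/-! ### The five invariant subspaces -/

theorem isKClosed_shPlus : IsKClosed (fun k _ => 0 ≤ k) := by
  constructor <;> intros <;> omega

theorem isKClosed_shMinus : IsKClosed (fun k L => k ≤ -(L + 4)) := by
  constructor <;> intros <;> push_cast at * <;> omega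

theorem isKClosed_iPlus : IsKClosed (fun k L => -(L + 1) ≤ k) := by
  constructor <;> intros <;> push_cast at * <;> omega

theorem isKClosed_iMinus : IsKClosed (fun k _ => k ≤ -3) := by
  constructor <;> intros <;> omega

theorem isKClosed_jMid : IsKClosed (fun k L => -(L + 1) ≤ k ∧ k ≤ -3) := by
  constructor <;> intros <;> push_cast at * <;> omega

/-- The subspace `Sh⁺`. -/
def shPlus : LieSubmodule ℂ Gl2HC Sh := closedSpan _ isKClosed_shPlus

/-- The subspace `Sh⁻`. -/
def shMinus : LieSubmodule ℂ Gl2HC Sh := closedSpan _ isKClosed_shMinus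

/-- The subspace `I⁺`. -/
def iPlus : LieSubmodule ℂ Gl2HC Sh := closedSpan _ isKClosed_iPlus

/-- The subspace `I⁻`. -/
def iMinus : LieSubmodule ℂ Gl2HC Sh := closedSpan _ isKClosed_iMinus

/-- The subspace `J`. -/
def jMid : LieSubmodule ℂ Gl2HC Sh := closedSpan _ isKClosed_jMid

section

variable (k : ℤ) (L : ℕ)

theorem kSupp_shPlus : kSupp shPlus k L ↔ 0 ≤ k := kSupp_closedSpan _ _ k L

theorem kSupp_shMinus : kSupp shMinus k L ↔ k ≤ -(L + 4) := kSupp_closedSpan _ _ k L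

theorem kSupp_iPlus : kSupp iPlus k L ↔ -(L + 1) ≤ k := kSupp_closedSpan _ _ k L

theorem kSupp_iMinus : kSupp iMinus k L ↔ k ≤ -3 := kSupp_closedSpan _ _ k L

theorem kSupp_jMid : kSupp jMid k L ↔ -(L + 1) ≤ k ∧ k ≤ -3 := kSupp_closedSpan _ _ k L

theorem kSupp_bot : kSupp ⊥ k L ↔ False := iff_false_intro (not_kSupp_bot k L)

theorem kSupp_top_iff : kSupp ⊤ k L ↔ True := iff_true_intro (kSupp_top k L)

end

theorem isLocalPair_of {W R : LieSubmodule ℂ Gl2HC Sh} {P Q : ℤ → ℤ → Prop}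
    (hW : ∀ (k : ℤ) (L : ℕ), kSupp W k L ↔ P k L) (hR : ∀ (k : ℤ) (L : ℕ), kSupp R k L ↔ Q k L)
    (hQP : ∀ (k : ℤ) (L : ℕ), Q k L → P k L) (k₀ : ℤ) (L₀ : ℕ) (h₀ : P k₀ L₀ ∧ ¬Q k₀ L₀)
    (h : ∀ (k : ℤ) (L : ℕ) (k' : ℤ) (L' : ℕ), P k L → ¬Q k L → P k' L' →
      Passable (k + L + 1) (k' + L' + 1) ∧ Passable k k') : IsLocalPair W R where
  le := le_iff_kSupp.2 fun k L h1 => (hW k L).2 (hQP k L ((hR k L).1 h1))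
  not_le h1 := h₀.2 ((hR _ _).1 (le_iff_kSupp.1 h1 _ _ ((hW _ _).2 h₀.1)))
  reach k L k' L' h1 h2 h3 := h k L k' L' ((hW _ _).1 h1) (fun h4 => h2 ((hR _ _).2 h4))
    ((hW _ _).1 h3)

/-- In this and the next five results the K-types of `W` outside `R` fill one pair of zones for `(x,
y)`, from which all of `W` is reachable; the explicit K-type shows that the pair of zones is
nonempty. -/
theorem isLocalPair_shPlus : IsLocalPair shPlus ⊥ :=
  isLocalPair_of (P := fun k _ => 0 ≤ k) (Q := fun _ _ => False) kSupp_shPlus kSupp_bot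
    (fun _ _ h => h.elim) 0 0 ⟨by omega, id⟩ (by intros; unfold Passable; omega)

theorem isLocalPair_shMinus : IsLocalPair shMinus ⊥ :=
  isLocalPair_of (P := fun k L => k ≤ -(L + 4)) (Q := fun _ _ => False) kSupp_shMinus kSupp_bot
    (fun _ _ h => h.elim) (-4) 0 ⟨by omega, id⟩ (by intros; unfold Passable; omega)

theorem isLocalPair_jMid : IsLocalPair jMid ⊥ :=
  isLocalPair_of (P := fun k L => -(L + 1) ≤ k ∧ k ≤ -3) (Q := fun _ _ => False) kSupp_jMid
    kSupp_bot (fun _ _ h => h.elim) (-3) 2 ⟨by omega, id⟩ (by intros; unfold Passable; omega)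

theorem isLocalPair_iPlus : IsLocalPair iPlus (shPlus ⊔ jMid) :=
  isLocalPair_of (P := fun k L => -(L + 1) ≤ k)
    (Q := fun k L => 0 ≤ k ∨ (-(L + 1) ≤ k ∧ k ≤ -3)) kSupp_iPlus
    (fun k L => by rw [kSupp_sup, kSupp_shPlus, kSupp_jMid])
    (by intros; omega) (-1) 0 (by omega) (by intros; unfold Passable; omega)

theorem isLocalPair_iMinus : IsLocalPair iMinus (shMinus ⊔ jMid) :=
  isLocalPair_of (P := fun k _ => k ≤ -3)
    (Q := fun k L => k ≤ -(L + 4) ∨ (-(L + 1) ≤ k ∧ k ≤ -3)) kSupp_iMinus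
    (fun k L => by rw [kSupp_sup, kSupp_shMinus, kSupp_jMid])
    (by intros; omega) (-3) 0 (by omega) (by intros; unfold Passable; omega)

theorem isLocalPair_top : IsLocalPair ⊤ (iPlus ⊔ iMinus) :=
  isLocalPair_of (P := fun _ _ => True)
    (Q := fun k L => -(L + 1) ≤ k ∨ k ≤ -3) kSupp_top_iff
    (fun k L => by rw [kSupp_sup, kSupp_iPlus, kSupp_iMinus])
    (by intros; trivial) (-2) 0 ⟨trivial, by omega⟩ (by intros; unfold Passable; omega)

/-! ### Classification of the invariant subspaces -/

/-- The invariant subspaces different from `0` and `Sh`. -/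
theorem invariant_subspace_iff (W : LieSubmodule ℂ Gl2HC Sh) :
    (W ≠ ⊥ ∧ W ≠ ⊤) ↔ ∃ S : Set (LieSubmodule ℂ Gl2HC Sh),
      S.Nonempty ∧ S ⊆ {shPlus, shMinus, iPlus, iMinus, jMid} ∧ W = sSup S := by
  constructor
  · rintro ⟨hbot, htop⟩
    set S := {U | U ∈ ({shPlus, shMinus, iPlus, iMinus, jMid} : Set (LieSubmodule ℂ Gl2HC Sh)) ∧
      U ≤ W} with hS
    -- The cases are the six pairs of zones. Each K-type of `W` generates the member of the list
    -- attached to its pair, except `N(Z)⁻²`, which generates `Sh` and so cannot occur.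
    have key : ∀ (k : ℤ) (L : ℕ), kSupp W k L → ∃ U ∈ S, kSupp U k L := by
      intro k L h
      by_cases h1 : 0 ≤ k
      · exact ⟨shPlus, ⟨by simp, isLocalPair_shPlus.le_of_kSupp ((kSupp_shPlus k L).2 h1)
          (not_kSupp_bot k L) h⟩, (kSupp_shPlus k L).2 h1⟩
      by_cases h2 : k ≤ -(L + 4)
      · exact ⟨shMinus, ⟨by simp, isLocalPair_shMinus.le_of_kSupp ((kSupp_shMinus k L).2 h2)
          (not_kSupp_bot k L) h⟩, (kSupp_shMinus k L).2 h2⟩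
      by_cases h3 : -(L + 1) ≤ k ∧ k ≤ -3
      · exact ⟨jMid, ⟨by simp, isLocalPair_jMid.le_of_kSupp ((kSupp_jMid k L).2 h3)
          (not_kSupp_bot k L) h⟩, (kSupp_jMid k L).2 h3⟩
      by_cases h4 : -(L + 1) ≤ k
      · refine ⟨iPlus, ⟨by simp, isLocalPair_iPlus.le_of_kSupp ((kSupp_iPlus k L).2 h4)
          ?_ h⟩, (kSupp_iPlus k L).2 h4⟩
        rw [kSupp_sup, kSupp_shPlus, kSupp_jMid]
        omega
      by_cases h5 : k ≤ -3
      · refine ⟨iMinus, ⟨by simp, isLocalPair_iMinus.le_of_kSupp ((kSupp_iMinus k L).2 h5)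
          ?_ h⟩, (kSupp_iMinus k L).2 h5⟩
        rw [kSupp_sup, kSupp_shMinus, kSupp_jMid]
        omega
      · refine absurd (eq_top_iff.2 (isLocalPair_top.le_of_kSupp (kSupp_top k L) ?_ h)) htop
        rw [kSupp_sup, kSupp_iPlus, kSupp_iMinus]
        omega
    refine ⟨S, ?_, fun U hU => hU.1, le_antisymm ?_ (sSup_le fun U hU => hU.2)⟩
    · obtain ⟨k, L, h, -⟩ := exists_kSupp_of_not_le (mt le_bot_iff.1 hbot)
      obtain ⟨U, hU, -⟩ := key k L h
      exact ⟨U, hU⟩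
    · refine le_iff_kSupp.2 fun k L h => ?_
      obtain ⟨U, hU, hk⟩ := key k L h
      exact le_iff_kSupp.1 (le_sSup hU) k L hk
  · rintro ⟨S, ⟨U, hU⟩, hS, rfl⟩
    constructor
    · refine ne_bot_of_le_ne_bot ?_ (le_sSup hU)
      have hne : ∀ {V : LieSubmodule ℂ Gl2HC Sh} (k : ℤ) (L : ℕ), kSupp V k L → V ≠ ⊥ := by
        rintro V k L h rfl
        exact not_kSupp_bot k L h
      rcases hS hU with rfl | rfl | rfl | rfl | rfl
      · exact hne 0 0 ((kSupp_shPlus _ _).2 (by omega))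
      · exact hne (-4) 0 ((kSupp_shMinus _ _).2 (by omega))
      · exact hne 0 0 ((kSupp_iPlus _ _).2 (by omega))
      · exact hne (-4) 0 ((kSupp_iMinus _ _).2 (by omega))
      · exact hne (-3) 2 ((kSupp_jMid _ _).2 (by omega))
    -- All five subspaces lie in `I⁺ + I⁻`, which is proper because it misses `N(Z)⁻²`.
    · refine ne_top_of_le_ne_top (b := iPlus ⊔ iMinus) ?_ (sSup_le fun V hV => ?_)
      · exact fun h => isLocalPair_top.not_le h.ge
      · rw [le_iff_kSupp]
        intro k L
        rw [kSupp_sup, kSupp_iPlus, kSupp_iMinus]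
        rcases hS hV with rfl | rfl | rfl | rfl | rfl
        · rw [kSupp_shPlus]; omega
        · rw [kSupp_shMinus]; omega
        · rw [kSupp_iPlus]; omega
        · rw [kSupp_iMinus]; omega
        · rw [kSupp_jMid]; omega

/-! ### Irreducible components and the composition series -/

theorem IsLocalPair.isIrreducible_subquot {W R : LieSubmodule ℂ Gl2HC Sh} (h : IsLocalPair W R) :
    LieModule.IsIrreducible ℂ Gl2HC (Subquot W R) :=
  (isIrreducible_subquot_iff h.le).2 h.covBy

theorem IsLocalPair.isIrreducible {W : LieSubmodule ℂ Gl2HC Sh} (h : IsLocalPair W ⊥) :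
    LieModule.IsIrreducible ℂ Gl2HC W :=
  isIrreducible_of_equiv (nonempty_subquot_bot_equiv W).some h.isIrreducible_subquot

/-- Every irreducible subquotient is isomorphic to one of the six irreducible components. -/
theorem subquot_equiv_component {U V : LieSubmodule ℂ Gl2HC Sh} (hUV : U ≤ V)
    (hirr : LieModule.IsIrreducible ℂ Gl2HC (Subquot V U)) :
    Nonempty (Subquot V U ≃ₗ⁅ℂ, Gl2HC⁆ shPlus) ∨
    Nonempty (Subquot V U ≃ₗ⁅ℂ, Gl2HC⁆ shMinus) ∨
    Nonempty (Subquot V U ≃ₗ⁅ℂ, Gl2HC⁆ jMid) ∨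
    Nonempty (Subquot V U ≃ₗ⁅ℂ, Gl2HC⁆ Subquot iPlus (shPlus ⊔ jMid)) ∨
    Nonempty (Subquot V U ≃ₗ⁅ℂ, Gl2HC⁆ Subquot iMinus (shMinus ⊔ jMid)) ∨
    Nonempty (Subquot V U ≃ₗ⁅ℂ, Gl2HC⁆ Sh ⧸ (iPlus ⊔ iMinus)) := by
  have hcov := (isIrreducible_subquot_iff hUV).1 hirr
  -- Any K-type of `V` outside `U` decides the isomorphism class, according to its pair of zones.
  obtain ⟨k, L, hV, hU⟩ := exists_kSupp_of_not_le hcov.lt.not_ge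
  have hbot : ∀ {W : LieSubmodule ℂ Gl2HC Sh}, IsLocalPair W ⊥ → kSupp W k L →
      Nonempty (Subquot V U ≃ₗ⁅ℂ, Gl2HC⁆ W) := by
    intro W h hW
    obtain ⟨e⟩ := h.nonempty_equiv hcov hW (not_kSupp_bot k L) hV hU
    obtain ⟨e'⟩ := nonempty_subquot_bot_equiv W
    exact ⟨e.trans e'⟩
  by_cases h1 : 0 ≤ k
  · exact Or.inl (hbot isLocalPair_shPlus ((kSupp_shPlus k L).2 h1))
  by_cases h2 : k ≤ -(L + 4)
  · exact Or.inr (Or.inl (hbot isLocalPair_shMinus ((kSupp_shMinus k L).2 h2)))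
  by_cases h3 : -(L + 1) ≤ k ∧ k ≤ -3
  · exact Or.inr (Or.inr (Or.inl (hbot isLocalPair_jMid ((kSupp_jMid k L).2 h3))))
  by_cases h4 : -(L + 1) ≤ k
  · refine Or.inr (Or.inr (Or.inr (Or.inl (isLocalPair_iPlus.nonempty_equiv hcov
      ((kSupp_iPlus k L).2 h4) ?_ hV hU))))
    rw [kSupp_sup, kSupp_shPlus, kSupp_jMid]
    omega
  by_cases h5 : k ≤ -3
  · refine Or.inr (Or.inr (Or.inr (Or.inr (Or.inl (isLocalPair_iMinus.nonempty_equiv hcov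
      ((kSupp_iMinus k L).2 h5) ?_ hV hU)))))
    rw [kSupp_sup, kSupp_shMinus, kSupp_jMid]
    omega
  · obtain ⟨e⟩ := isLocalPair_top.nonempty_equiv hcov (kSupp_top k L) (by
      rw [kSupp_sup, kSupp_iPlus, kSupp_iMinus]
      omega) hV hU
    obtain ⟨e'⟩ := nonempty_subquot_top_equiv (iPlus ⊔ iMinus)
    exact Or.inr (Or.inr (Or.inr (Or.inr (Or.inr ⟨e.trans e'⟩))))

/-- The composition series. -/
def compSeries : Fin 7 → LieSubmodule ℂ Gl2HC Sh :=
  ![⊥, shPlus, shPlus ⊔ jMid, iPlus, iPlus ⊔ shMinus, iPlus ⊔ iMinus, ⊤]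

/-- The order in which the components occur in the composition series. -/
def compPerm : Equiv.Perm (Fin 6) := Equiv.ofBijective ![0, 3, 1, 2, 4, 5] (by decide)

theorem compSeries_strictMono : StrictMono compSeries := by
  refine Fin.strictMono_iff_lt_succ.2 fun i => ?_
  fin_cases i
  · exact isLocalPair_shPlus.covBy.lt
  · refine lt_of_kSupp (W := shPlus) (W' := shPlus ⊔ jMid) ?_ (-3) 2 ?_ ?_
    · simp only [kSupp_sup]; tauto
    · rw [kSupp_sup, kSupp_jMid]; omega
    · rw [kSupp_shPlus]; omega
  · exact isLocalPair_iPlus.covBy.lt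
  · refine lt_of_kSupp (W := iPlus) (W' := iPlus ⊔ shMinus) ?_ (-4) 0 ?_ ?_
    · simp only [kSupp_sup]; tauto
    · rw [kSupp_sup, kSupp_shMinus]; omega
    · rw [kSupp_iPlus]; omega
  · refine lt_of_kSupp (W := iPlus ⊔ shMinus) (W' := iPlus ⊔ iMinus) ?_ (-3) 0 ?_ ?_
    · intro k L
      rw [kSupp_sup, kSupp_sup, kSupp_iPlus, kSupp_shMinus, kSupp_iMinus]; omega
    · rw [kSupp_sup, kSupp_iMinus]; omega
    · rw [kSupp_sup, kSupp_iPlus, kSupp_shMinus]; omega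
  · exact isLocalPair_top.covBy.lt

theorem disjoint_shPlus_jMid : Disjoint shPlus jMid := by
  rw [disjoint_iff]
  refine eq_of_kSupp fun k L => ?_
  rw [kSupp_inf, kSupp_shPlus, kSupp_jMid, kSupp_bot, iff_false]
  omega

theorem disjoint_shMinus_jMid : Disjoint shMinus jMid := by
  rw [disjoint_iff]
  refine eq_of_kSupp fun k L => ?_
  rw [kSupp_inf, kSupp_shMinus, kSupp_jMid, kSupp_bot, iff_false]
  omega

theorem compFactor_jMid : Nonempty (Subquot (shPlus ⊔ jMid) shPlus ≃ₗ⁅ℂ, Gl2HC⁆ jMid) := by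
  obtain ⟨e⟩ := nonempty_subquotEquiv (sup_comm jMid shPlus)
    ((inf_comm _ _).trans (disjoint_iff.1 disjoint_shPlus_jMid))
  obtain ⟨e'⟩ := nonempty_subquot_bot_equiv jMid
  exact ⟨e.trans e'⟩

theorem compFactor_shMinus :
    Nonempty (Subquot (iPlus ⊔ shMinus) iPlus ≃ₗ⁅ℂ, Gl2HC⁆ shMinus) := by
  obtain ⟨e⟩ := nonempty_subquotEquiv (K := ⊥) (sup_comm shMinus iPlus) (eq_of_kSupp fun k L => by
    rw [kSupp_inf, kSupp_shMinus, kSupp_iPlus, kSupp_bot, iff_false]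
    omega)
  obtain ⟨e'⟩ := nonempty_subquot_bot_equiv shMinus
  exact ⟨e.trans e'⟩

/-- Second isomorphism theorem with `I⁻ ∩ (I⁺ + Sh⁻) = Sh⁻ + J`. -/
theorem compFactor_iMinus :
    Nonempty (Subquot (iPlus ⊔ iMinus) (iPlus ⊔ shMinus) ≃ₗ⁅ℂ, Gl2HC⁆
      Subquot iMinus (shMinus ⊔ jMid)) := by
  refine nonempty_subquotEquiv (eq_of_kSupp fun k L => ?_) (eq_of_kSupp fun k L => ?_)
  · rw [kSupp_sup, kSupp_sup, kSupp_sup, kSupp_iPlus, kSupp_iMinus, kSupp_shMinus]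
    omega
  · rw [kSupp_inf, kSupp_sup, kSupp_sup, kSupp_iPlus, kSupp_iMinus, kSupp_shMinus, kSupp_jMid]
    omega

end Biquaternion
end

open Biquaternion in
theorem mainTheorem5 :
    ∃ ShP ShM IP IM J : LieSubmodule ℂ Gl2HC Sh,
      -- the five spaces are the given spans (and these are invariant)
      ShP.toSubmodule = spanK (fun k L => 0 ≤ k) ∧
      ShM.toSubmodule = spanK (fun k L => k ≤ -(L + 4)) ∧
      IP.toSubmodule = spanK (fun k L => -(L + 1) ≤ k) ∧
      IM.toSubmodule = spanK (fun k L => k ≤ -3) ∧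
      J.toSubmodule = spanK (fun k L => -(L + 1) ≤ k ∧ k ≤ -3) ∧
      -- the proper invariant subspaces are these five and their sums
      (∀ W : LieSubmodule ℂ Gl2HC Sh, (W ≠ ⊥ ∧ W ≠ ⊤) ↔
        ∃ S : Set (LieSubmodule ℂ Gl2HC Sh),
          S.Nonempty ∧ S ⊆ {ShP, ShM, IP, IM, J} ∧ W = sSup S) ∧
      -- the sums in the denominators below are direct, and contained in the numerators
      Disjoint ShP J ∧ ShP ⊔ J ≤ IP ∧
      Disjoint ShM J ∧ ShM ⊔ J ≤ IM ∧
      -- the six components are irreducible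
      LieModule.IsIrreducible ℂ Gl2HC ShP ∧
      LieModule.IsIrreducible ℂ Gl2HC ShM ∧
      LieModule.IsIrreducible ℂ Gl2HC J ∧
      LieModule.IsIrreducible ℂ Gl2HC (Subquot IP (ShP ⊔ J)) ∧
      LieModule.IsIrreducible ℂ Gl2HC (Subquot IM (ShM ⊔ J)) ∧
      LieModule.IsIrreducible ℂ Gl2HC (Sh ⧸ (IP ⊔ IM)) ∧
      -- they are all the irreducible components: there is a composition series of length six
      -- whose factors are these six representations, each occurring exactly once, and every
      -- irreducible subquotient is isomorphic to one of them
      (∃ (c : Fin 7 → LieSubmodule ℂ Gl2HC Sh) (σ : Equiv.Perm (Fin 6)),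
        StrictMono c ∧ c 0 = ⊥ ∧ c 6 = ⊤ ∧
        Nonempty (Subquot (c (σ 0).succ) (c (σ 0).castSucc) ≃ₗ⁅ℂ, Gl2HC⁆ ShP) ∧
        Nonempty (Subquot (c (σ 1).succ) (c (σ 1).castSucc) ≃ₗ⁅ℂ, Gl2HC⁆ ShM) ∧
        Nonempty (Subquot (c (σ 2).succ) (c (σ 2).castSucc) ≃ₗ⁅ℂ, Gl2HC⁆ J) ∧
        Nonempty (Subquot (c (σ 3).succ) (c (σ 3).castSucc) ≃ₗ⁅ℂ, Gl2HC⁆ Subquot IP (ShP ⊔ J)) ∧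
        Nonempty (Subquot (c (σ 4).succ) (c (σ 4).castSucc) ≃ₗ⁅ℂ, Gl2HC⁆ Subquot IM (ShM ⊔ J)) ∧
        Nonempty (Subquot (c (σ 5).succ) (c (σ 5).castSucc) ≃ₗ⁅ℂ, Gl2HC⁆ Sh ⧸ (IP ⊔ IM))) ∧
      (∀ U V : LieSubmodule ℂ Gl2HC Sh, U ≤ V → LieModule.IsIrreducible ℂ Gl2HC (Subquot V U) →
        Nonempty (Subquot V U ≃ₗ⁅ℂ, Gl2HC⁆ ShP) ∨
        Nonempty (Subquot V U ≃ₗ⁅ℂ, Gl2HC⁆ ShM) ∨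
        Nonempty (Subquot V U ≃ₗ⁅ℂ, Gl2HC⁆ J) ∨
        Nonempty (Subquot V U ≃ₗ⁅ℂ, Gl2HC⁆ Subquot IP (ShP ⊔ J)) ∨
        Nonempty (Subquot V U ≃ₗ⁅ℂ, Gl2HC⁆ Subquot IM (ShM ⊔ J)) ∨
        Nonempty (Subquot V U ≃ₗ⁅ℂ, Gl2HC⁆ Sh ⧸ (IP ⊔ IM))) := by
  exact ⟨shPlus, shMinus, iPlus, iMinus, jMid, rfl, rfl, rfl, rfl, rfl, invariant_subspace_iff,
    disjoint_shPlus_jMid, isLocalPair_iPlus.le, disjoint_shMinus_jMid, isLocalPair_iMinus.le,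
    isLocalPair_shPlus.isIrreducible, isLocalPair_shMinus.isIrreducible,
    isLocalPair_jMid.isIrreducible, isLocalPair_iPlus.isIrreducible_subquot,
    isLocalPair_iMinus.isIrreducible_subquot,
    (isIrreducible_quot_iff _).2 isLocalPair_top.covBy.isCoatom,
    ⟨compSeries, compPerm, compSeries_strictMono, rfl, rfl, nonempty_subquot_bot_equiv shPlus,
      compFactor_shMinus, compFactor_jMid, ⟨LieModuleEquiv.refl⟩, compFactor_iMinus,
      nonempty_subquot_top_equiv _⟩,
    fun _ _ => subquot_equiv_component⟩
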